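/- Let $1\le r<\min\{p,n\}$, let $M\in\mathbb C^{p\times n}$ have singular value decomposition $M=\sum_{j=1}^{\min\{p,n\}}\sigma_j u_jv_j^H$ with $\sigma_1\ge\sigma_2\ge\dots\ge 0$ and $\sigma_r>\sigma_{r+1}$, and let $\widehat M=M+E$, where the entries of the random $p\times n$ matrix $E$ are i.i.d. (circularly symmetric) complex Gaussian with mean zero and variance $\sigma^2$, $\sigma\ge 0$. Let $U=[u_1,\dots,u_r]$, and let $\widehat U=[\hat u_1,\dots,\hat u_r]$ be the matrix of the first $r$ left singular vectors in a singular value decomposition $\widehat M=\sum_{j}\hat\sigma_j\hat u_j\hat v_j^H$, $\hat\sigma_1\ge\hat\sigma_2\ge\dots\ge0$. Let $\operatorname{dist}(\widehat U,U)=\|\sin\Theta(\widehat U,U)\|$ (spectral norm), where $\Theta(\widehat U,U)$ is the diagonal matrix of the canonical angles $\theta_j=\arccos\sigma_j(\widehat U^HU)$, $j=1,\dots,r$. If $$B:=\frac{12\sigma\sigma_1\sqrt p+16\sigma^2\max\{\sqrt{pn},\,p\}}{\sigma_r^2-\sigma_{r+1}^2}<0.586,$$ then, with probability at least $1-3e^{-p/2}$,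 $\operatorname{dist}(\widehat U,U)\le B$ (for every choice of the singular value decomposition of $\widehat M$). Moreover, if $p\le n$ and the singular values of $M$ scale with $\sqrt n$, say $\sigma_1=a\sqrt n$, $\sigma_r=b\sqrt n$ and $\sigma_{r+1}=c\sqrt n$, then the bound is proportional to $\sqrt{p/n}$: $B=\frac{12\sigma a+16\sigma^2}{b^2-c^2}\sqrt{p/n}$. -/

import Mathlib

open MeasureTheory ProbabilityTheory
open scoped Matrix NNReal

/-- The circularly symmetric complex Gaussian law on `ℂ` with mean zero and variance `v`
(that is, `E |z|^2 = v`): real and imaginary part are independent, real Gaussian, each with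
mean zero and variance `v / 2`. -/
noncomputable def complexGaussian (v : ℝ≥0) : Measure ℂ :=
  ((gaussianReal 0 (v / 2)).prod (gaussianReal 0 (v / 2))).map Complex.measurableEquivRealProd.symm

/-- `E` is a random matrix on the probability space `(Ω, μ)` whose entries are independent
complex Gaussian variables with mean zero and variance `v`. -/
structure IsIIDComplexGaussian {Ω : Type*} [MeasurableSpace Ω] (μ : Measure Ω) {p n : ℕ}
    (E : Ω → Matrix (Fin p) (Fin n) ℂ) (v : ℝ≥0) : Prop where
  hasLaw : ∀ i j, HasLaw (fun ω => E ω i j) (complexGaussian v) μ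
  indep : iIndepFun (fun (ij : Fin p × Fin n) ω => E ω ij.1 ij.2) μ

/-- `M = ∑ j, s j • (u j) (v j)ᴴ` is a (thin) singular value decomposition of `M`: the singular
values `s` are nonnegative and sorted in descending order, the columns of `u` (the left singular
vectors) are orthonormal and so are the columns of `v` (the right singular vectors). -/
structure IsSVD {p n : ℕ} (M : Matrix (Fin p) (Fin n) ℂ) (s : Fin (min p n) → ℝ)
    (u : Matrix (Fin p) (Fin (min p n)) ℂ) (v : Matrix (Fin n) (Fin (min p n)) ℂ) : Prop where
  nonneg : ∀ j, 0 ≤ s j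
  antitone : Antitone s
  left_orthonormal : uᴴ * u = 1
  right_orthonormal : vᴴ * v = 1
  eq_mul : M = u * Matrix.diagonal (fun j => (s j : ℂ)) * vᴴ

/-- The matrix made of the first `r` columns of `u`. -/
def firstCols {p m r : ℕ} (hr : r ≤ m) (u : Matrix (Fin p) (Fin m) ℂ) :
    Matrix (Fin p) (Fin r) ℂ :=
  u.submatrix id (Fin.castLE hr)

/-- The `j`-th canonical angle `arccos (σ_j (Ûᴴ U))` between the column spaces of the `p × r`
matrices `Û` and `U` with orthonormal columns (`j` counts from zero). -/
noncomputable def canonicalAngle {p r : ℕ} (Uhat U : Matrix (Fin p) (Fin r) ℂ) (j : Fin r) : ℝ :=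
  Real.arccos ((Matrix.toEuclideanLin (Uhatᴴ * U)).singularValues j)

open scoped Matrix.Norms.L2Operator in
/-- The distance `‖sin Θ(Û, U)‖` (spectral norm) between the column spaces of the `p × r`
matrices `Û` and `U` with orthonormal columns. -/
noncomputable def subspaceDist {p r : ℕ} (Uhat U : Matrix (Fin p) (Fin r) ℂ) : ℝ :=
  ‖Matrix.diagonal (fun j => Real.sin (canonicalAngle Uhat U j))‖

/-- The upper bound
`(12 σ σ₁ √p + 16 σ² max {√(p n), p}) / (σᵣ² - σᵣ₊₁²)`,
with `s1`, `sr`, `sr1` for `σ₁`, `σᵣ`, `σᵣ₊₁`. -/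
noncomputable def perturbationBound (p n : ℕ) (σ s1 sr sr1 : ℝ) : ℝ :=
  (12 * σ * s1 * √(p : ℝ) + 16 * σ ^ 2 * max (√((p : ℝ) * n)) (p : ℝ)) / (sr ^ 2 - sr1 ^ 2)

/-! The noise adds `n σ² I` to `M Mᴴ` on average, and a multiple of the identity moves no
eigenvector. So everything rests on `Δ = M̂ M̂ᴴ - M Mᴴ - n σ² I` and a bound `‖Δ‖ ≤ τ`, where `2 τ`
is the numerator of `B`.

Deterministic half: let `x` be the image under `U` of a right singular vector of `Ûᴴ U`, and `y` its
residual after projection to the span of `Û`; then `‖y‖ / ‖x‖` is the sine of a canonical angle.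
Evaluating `Δ` between `y` and `x` gives at least `σ_r² ‖y‖²` from `M Mᴴ` and at most `σ̂_{r+1}²
‖y‖²` from `M̂ M̂ᴴ`. Weyl's inequality removes `σ̂_{r+1}`, leaving `(gap - τ) ‖y‖ ≤ τ ‖x‖`
(`norm_residual_le`). As `τ ≤ B gap / 2` and `B < 1`, the ratio is at most `B` (`subspaceDist_le`).

Probabilistic half: an average over a random Gaussian direction replaces an ε-net. If `‖Δ‖ > τ`,
then the quadratic form of `Δ` or of `-Δ` is at least `3τ/5` times the squared norm on a cone around
an extremal eigenvector, and this cone has Gaussian mass at least `5^(-p)`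
(`le_pi_complexGaussian_cone`). Hence the average over `x` of `exp (±θ xᴴ Δ x / ‖x‖²)` is large for
one sign. For fixed `x` its expectation over the noise is an explicit product of noncentral
exponential moments (`lintegral_exp_gramDiff_le`). Tonelli and Markov, with `θ` from `exists_tilt`,
finish the estimate (`measure_exists_cone_le`). -/

open scoped InnerProductSpace ENNReal

/-! ### Weyl's inequality and the sin Θ argument for spectral forms -/

section SpectralForm

variable {H : Type*} [NormedAddCommGroup H] [InnerProductSpace ℂ H] {m : ℕ}

/-- The sesquilinear form `(y, x) ↦ ⟪y, (∑ j, a j • e j (e j)ᴴ) x⟫`. -/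
noncomputable def spectralForm (a : Fin m → ℝ) (e : Fin m → H) (y x : H) : ℂ :=
  ∑ j, (a j : ℂ) * (⟪y, e j⟫_ℂ * ⟪e j, x⟫_ℂ)

theorem inner_mul_inner_swap (x y : H) : ⟪x, y⟫_ℂ * ⟪y, x⟫_ℂ = ((‖⟪y, x⟫_ℂ‖ ^ 2 : ℝ) : ℂ) := by
  rw [← inner_conj_symm x y, RCLike.conj_mul]
  simp

theorem spectralForm_self_re (a : Fin m → ℝ) (e : Fin m → H) (x : H) :
    (spectralForm a e x x).re = ∑ j, a j * ‖⟪e j, x⟫_ℂ‖ ^ 2 := by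
  simp only [spectralForm, inner_mul_inner_swap, ← Complex.ofReal_mul, ← Complex.ofReal_sum,
    Complex.ofReal_re]

theorem Orthonormal.norm_sq_sum_smul {e : Fin m → H} (he : Orthonormal ℂ e) (w : Fin m → ℂ) :
    ‖∑ j, w j • e j‖ ^ 2 = ∑ j, ‖w j‖ ^ 2 := by
  have h := he.inner_sum w w Finset.univ
  rw [inner_self_eq_norm_sq_to_K] at h
  simp only [RCLike.conj_mul] at h
  exact_mod_cast h

/-- Weyl's inequality for the eigenvalue with index `r`. -/
theorem weyl_spectralForm {r : ℕ} (hrm : r < m) {a b : Fin m → ℝ} {e f : Fin m → H}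
    (he : Orthonormal ℂ e) (hf : Orthonormal ℂ f) (ha : Antitone a) (hb : Antitone b)
    (ha0 : ∀ j, 0 ≤ a j) {c τ : ℝ}
    (hΔ : ∀ y x, ‖spectralForm b f y x - spectralForm a e y x - c * ⟪y, x⟫_ℂ‖ ≤ τ * ‖y‖ * ‖x‖) :
    b ⟨r, hrm⟩ ≤ a ⟨r, hrm⟩ + c + τ := by
  -- Dimension count: `L` misses the coordinate `r`, so it has a kernel. A kernel vector gives `z`
  -- in the span of `f 0, …, f r` that is orthogonal to `e 0, …, e (r - 1)`, the test vector of the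
  -- min-max principle.
  let L : (Fin m → ℂ) →ₗ[ℂ] (Fin m → ℂ) :=
    { toFun := fun w j => if (j : ℕ) < r then ⟪e j, ∑ k, w k • f k⟫_ℂ
        else if (j : ℕ) = r then 0 else w j
      map_add' := by
        intro w w'
        ext j
        simp only [Pi.add_apply, add_smul, Finset.sum_add_distrib, inner_add_right]
        split_ifs <;> first | rfl | simp only [add_zero]
      map_smul' := by
        intro k w
        ext j
        simp only [Pi.smul_apply, smul_eq_mul, mul_smul, ← Finset.smul_sum, inner_smul_right,
          RingHom.id_apply]
        split_ifs <;> first | rfl | simp only [mul_zero] }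
  have hL : ¬ Function.Injective L := by
    rw [LinearMap.injective_iff_surjective]
    intro hs
    obtain ⟨w, hw⟩ := hs (Pi.single ⟨r, hrm⟩ 1)
    have := congrFun hw ⟨r, hrm⟩
    simp [L] at this
  obtain ⟨w, hw0, hw⟩ : ∃ w, L w = 0 ∧ w ≠ 0 := by
    by_contra! hcon
    exact hL ((injective_iff_map_eq_zero L).2 hcon)
  have h1 : ∀ j : Fin m, (j : ℕ) < r → ⟪e j, ∑ k, w k • f k⟫_ℂ = 0 := by
    intro j hj
    have := congrFun hw0 j
    simpa [L, hj] using this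
  have h2 : ∀ j : Fin m, r < (j : ℕ) → w j = 0 := by
    intro j hj
    have := congrFun hw0 j
    simpa [L, hj.not_gt, hj.ne'] using this
  set z := ∑ k, w k • f k with hz
  have hzn : ‖z‖ ^ 2 = ∑ j, ‖w j‖ ^ 2 := hf.norm_sq_sum_smul w
  have hzw : ∀ j, ⟪f j, z⟫_ℂ = w j := fun j => hf.inner_right_fintype w j
  have hpos : 0 < ‖z‖ ^ 2 := by
    rw [hzn]
    obtain ⟨j, hj⟩ := Function.ne_iff.1 hw
    exact Finset.sum_pos' (fun _ _ => by positivity)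
      ⟨j, Finset.mem_univ _, by have := norm_pos_iff.2 hj; positivity⟩
  have hB : b ⟨r, hrm⟩ * ‖z‖ ^ 2 ≤ (spectralForm b f z z).re := by
    rw [spectralForm_self_re, hzn, Finset.mul_sum]
    refine Finset.sum_le_sum fun j _ => ?_
    rw [hzw]
    by_cases hj : r < (j : ℕ)
    · simp [h2 j hj]
    · exact mul_le_mul_of_nonneg_right (hb (Fin.le_def.2 (not_lt.1 hj))) (by positivity)
  -- The family `e` need not span `H`, so only Bessel's inequality is available; this is why `a` has
  -- to be nonnegative.
  have hA : (spectralForm a e z z).re ≤ a ⟨r, hrm⟩ * ‖z‖ ^ 2 := by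
    rw [spectralForm_self_re]
    calc ∑ j, a j * ‖⟪e j, z⟫_ℂ‖ ^ 2 ≤ ∑ j, a ⟨r, hrm⟩ * ‖⟪e j, z⟫_ℂ‖ ^ 2 := by
          refine Finset.sum_le_sum fun j _ => ?_
          by_cases hj : (j : ℕ) < r
          · simp [h1 j hj]
          · exact mul_le_mul_of_nonneg_right (ha (Fin.le_def.2 (not_lt.1 hj))) (by positivity)
      _ = a ⟨r, hrm⟩ * ∑ j, ‖⟪e j, z⟫_ℂ‖ ^ 2 := by rw [Finset.mul_sum]
      _ ≤ _ := mul_le_mul_of_nonneg_left (he.sum_inner_products_le z) (ha0 _)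
  have h3 := (Complex.re_le_norm _).trans (hΔ z z)
  rw [inner_self_eq_norm_sq_to_K] at h3
  have h4 : ((c : ℂ) * (((‖z‖ : ℝ) : ℂ)) ^ 2).re = c * ‖z‖ ^ 2 := by
    rw [← Complex.ofReal_pow, ← Complex.ofReal_mul, Complex.ofReal_re]
  simp only [Complex.sub_re, Complex.coe_algebraMap] at h3
  rw [h4] at h3
  have : (b ⟨r, hrm⟩) * ‖z‖ ^ 2 ≤ (a ⟨r, hrm⟩ + c + τ) * ‖z‖ ^ 2 := by nlinarith
  exact le_of_mul_le_mul_right this hpos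

/-- The `sin Θ` theorem: if `x` is in the span of the first `r` vectors of `e` and the
projection of its residual `x - P x` back to that span is `(1 - t) x`, then the residual is small. -/
theorem norm_residual_le {r : ℕ} (hrm : r < m) {a b : Fin m → ℝ} {e f : Fin m → H}
    (he : Orthonormal ℂ e) (hf : Orthonormal ℂ f) (ha : Antitone a) (hb : Antitone b)
    (ha0 : ∀ j, 0 ≤ a j) (hb0 : ∀ j, 0 ≤ b j) {c τ : ℝ}
    (hΔ : ∀ y x, ‖spectralForm b f y x - spectralForm a e y x - c * ⟪y, x⟫_ℂ‖ ≤ τ * ‖y‖ * ‖x‖)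
    {x y : H} {t : ℝ} (hx : x = ∑ j, ⟪e j, x⟫_ℂ • e j)
    (hxr : ∀ j : Fin m, r ≤ (j : ℕ) → ⟪e j, x⟫_ℂ = 0)
    (hyf : ∀ j : Fin m, (j : ℕ) < r → ⟪f j, y⟫_ℂ = 0)
    (hfx : ∀ j : Fin m, r ≤ (j : ℕ) → ⟪f j, x⟫_ℂ = ⟪f j, y⟫_ℂ)
    (hyx : ⟪y, x⟫_ℂ = (‖y‖ : ℂ) ^ 2)
    (hey : ∀ j : Fin m, (j : ℕ) < r → ⟪e j, y⟫_ℂ = t * ⟪e j, x⟫_ℂ) :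
    (a ⟨r - 1, (Nat.sub_le r 1).trans_lt hrm⟩ - a ⟨r, hrm⟩ - τ) * ‖y‖ ≤ τ * ‖x‖ := by
  set ar := a ⟨r - 1, (Nat.sub_le r 1).trans_lt hrm⟩
  have hweyl := weyl_spectralForm hrm he hf ha hb ha0 hΔ
  have hxn : ‖x‖ ^ 2 = ∑ j, ‖⟪e j, x⟫_ℂ‖ ^ 2 := by
    conv_lhs => rw [hx]
    exact he.norm_sq_sum_smul _
  have hye : ∀ j : Fin m, ⟪y, e j⟫_ℂ * ⟪e j, x⟫_ℂ = ((t * ‖⟪e j, x⟫_ℂ‖ ^ 2 : ℝ) : ℂ) := by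
    intro j
    by_cases hj : (j : ℕ) < r
    · rw [← inner_conj_symm y, hey j hj, map_mul, mul_assoc, RCLike.conj_mul]
      simp
    · simp [hxr j (not_lt.1 hj)]
  have hty : ‖y‖ ^ 2 = t * ‖x‖ ^ 2 := by
    have h : ⟪y, x⟫_ℂ = ((t * ‖x‖ ^ 2 : ℝ) : ℂ) := by
      conv_lhs => rw [hx]
      rw [inner_sum, hxn, Finset.mul_sum, Complex.ofReal_sum]
      refine Finset.sum_congr rfl fun j _ => ?_
      rw [inner_smul_right, mul_comm, hye]
    rw [hyx] at h
    exact_mod_cast h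
  have hA : ar * ‖y‖ ^ 2 ≤ (spectralForm a e y x).re := by
    simp only [spectralForm, hye, ← Complex.ofReal_mul, ← Complex.ofReal_sum, Complex.ofReal_re]
    by_cases hx0 : x = 0
    · have : ‖y‖ ^ 2 = 0 := by rw [hty, hx0]; simp
      simp [this, hx0]
    -- In the application `t` is a squared sine; here its sign is read off from `‖y‖² = t ‖x‖²`.
    have ht : 0 ≤ t := by
      have : 0 < ‖x‖ := norm_pos_iff.2 hx0
      by_contra! hlt
      nlinarith [sq_nonneg ‖y‖, mul_pos_of_neg_of_neg hlt (neg_lt_zero.2 (sq_pos_of_pos this))]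
    rw [hty, hxn, Finset.mul_sum, Finset.mul_sum]
    refine Finset.sum_le_sum fun j _ => ?_
    by_cases hj : (j : ℕ) < r
    · exact mul_le_mul_of_nonneg_right (ha (Fin.le_def.2 (Nat.le_sub_one_of_lt hj)))
        (by positivity)
    · simp [hxr j (not_lt.1 hj)]
  have hB : (spectralForm b f y x).re ≤ b ⟨r, hrm⟩ * ‖y‖ ^ 2 := by
    have h1 : ∀ j : Fin m, ⟪y, f j⟫_ℂ * ⟪f j, x⟫_ℂ = ((‖⟪f j, y⟫_ℂ‖ ^ 2 : ℝ) : ℂ) := by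
      intro j
      by_cases hj : (j : ℕ) < r
      · rw [← inner_conj_symm y, hyf j hj]; simp
      · rw [hfx j (not_lt.1 hj), inner_mul_inner_swap]
    simp only [spectralForm, h1, ← Complex.ofReal_mul, ← Complex.ofReal_sum, Complex.ofReal_re]
    calc ∑ j, b j * ‖⟪f j, y⟫_ℂ‖ ^ 2 ≤ ∑ j, b ⟨r, hrm⟩ * ‖⟪f j, y⟫_ℂ‖ ^ 2 := by
          refine Finset.sum_le_sum fun j _ => ?_
          by_cases hj : (j : ℕ) < r
          · simp [hyf j hj]
          · exact mul_le_mul_of_nonneg_right (hb (Fin.le_def.2 (not_lt.1 hj))) (by positivity)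
      _ = b ⟨r, hrm⟩ * ∑ j, ‖⟪f j, y⟫_ℂ‖ ^ 2 := by rw [Finset.mul_sum]
      _ ≤ _ := mul_le_mul_of_nonneg_left (hf.sum_inner_products_le y) (hb0 _)
  have h3 := (abs_le.1 ((Complex.abs_re_le_norm _).trans (hΔ y x))).1
  rw [hyx] at h3
  have h4 : ((c : ℂ) * (((‖y‖ : ℝ) : ℂ)) ^ 2).re = c * ‖y‖ ^ 2 := by
    rw [← Complex.ofReal_pow, ← Complex.ofReal_mul, Complex.ofReal_re]
  simp only [Complex.sub_re] at h3
  rw [h4] at h3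
  have h5 : b ⟨r, hrm⟩ * ‖y‖ ^ 2 ≤ (a ⟨r, hrm⟩ + c + τ) * ‖y‖ ^ 2 :=
    mul_le_mul_of_nonneg_right hweyl (by positivity)
  -- For `y ≠ 0` one factor `‖y‖` cancels. For `y = 0` the claim is `0 ≤ τ ‖x‖`, which follows from
  -- `hΔ x x`.
  rcases (norm_nonneg y).eq_or_lt with hy | hy
  · have hτ : 0 ≤ τ * ‖x‖ ^ 2 := by
      have := (norm_nonneg _).trans (hΔ x x)
      nlinarith
    rw [← hy, mul_zero]
    rcases (norm_nonneg x).eq_or_lt with hx | hx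
    · rw [← hx]; simp
    · by_contra! h
      nlinarith
  · refine le_of_mul_le_mul_right ?_ hy
    nlinarith

end SpectralForm

/-- Here `w` is an eigenvector of `Uᴴ P U`, with `P` the projection to the first `r` vectors of `f`,
and `q` is the squared cosine of a canonical angle. So `1 - q = ‖y‖² / ‖x‖²` for the residual `y = x
- P x`, and `norm_residual_le` applies with `t = 1 - q`. -/
theorem norm_sq_residual_le {H : Type*} [NormedAddCommGroup H] [InnerProductSpace ℂ H] {m r : ℕ}
    (hrm : r < m) {a b : Fin m → ℝ} {e f : Fin m → H}
    (he : Orthonormal ℂ e) (hf : Orthonormal ℂ f) (ha : Antitone a) (hb : Antitone b)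
    (ha0 : ∀ j, 0 ≤ a j) (hb0 : ∀ j, 0 ≤ b j) {c τ : ℝ}
    (hΔ : ∀ y x, ‖spectralForm b f y x - spectralForm a e y x - c * ⟪y, x⟫_ℂ‖ ≤ τ * ‖y‖ * ‖x‖)
    {B q : ℝ} (hB1 : B < 1)
    (hgap : a ⟨r, hrm⟩ < a ⟨r - 1, (Nat.sub_le r 1).trans_lt hrm⟩)
    (hτ : 2 * τ ≤ B * (a ⟨r - 1, (Nat.sub_le r 1).trans_lt hrm⟩ - a ⟨r, hrm⟩))
    {w : Fin r → ℂ} (hw0 : w ≠ 0) {x : H} (hx : x = ∑ k, w k • e (k.castLE hrm.le))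
    (hw : ∀ k : Fin r, ⟪e (k.castLE hrm.le),
      ∑ l : Fin r, ⟪f (l.castLE hrm.le), x⟫_ℂ • f (l.castLE hrm.le)⟫_ℂ = q * w k) :
    1 - q ≤ B ^ 2 := by
  set ι : Fin r → Fin m := Fin.castLE hrm.le with hι
  have hιinj : Function.Injective ι := Fin.castLE_injective hrm.le
  have hιex : ∀ j : Fin m, (j : ℕ) < r → ∃ k, ι k = j := fun j hj => ⟨⟨j, hj⟩, rfl⟩
  have hιlt : ∀ k, (ι k : ℕ) < r := fun k => k.2
  have hek : ∀ k, ⟪e (ι k), x⟫_ℂ = w k := fun k => by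
    rw [hx]; exact (he.comp ι hιinj).inner_right_fintype w k
  have hex : ∀ j : Fin m, r ≤ (j : ℕ) → ⟪e j, x⟫_ℂ = 0 := fun j hj => by
    rw [hx, inner_sum]
    refine Finset.sum_eq_zero fun k _ => ?_
    have : j ≠ ι k := fun h => (hιlt k).not_ge (h ▸ hj)
    rw [inner_smul_right, he.2 this, mul_zero]
  set P := ∑ l : Fin r, ⟪f (ι l), x⟫_ℂ • f (ι l) with hP
  have hPf : ∀ k, ⟪f (ι k), P⟫_ℂ = ⟪f (ι k), x⟫_ℂ := fun k =>
    (hf.comp ι hιinj).inner_right_fintype _ k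
  have hPf' : ∀ j : Fin m, r ≤ (j : ℕ) → ⟪f j, P⟫_ℂ = 0 := fun j hj => by
    rw [hP, inner_sum]
    refine Finset.sum_eq_zero fun k _ => ?_
    have : j ≠ ι k := fun h => (hιlt k).not_ge (h ▸ hj)
    rw [inner_smul_right, hf.2 this, mul_zero]
  set y := x - P with hy
  have hyf : ∀ j : Fin m, (j : ℕ) < r → ⟪f j, y⟫_ℂ = 0 := fun j hj => by
    obtain ⟨k, rfl⟩ := hιex j hj
    rw [hy, inner_sub_right, hPf, sub_self]
  have hyP : ⟪y, P⟫_ℂ = 0 := by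
    rw [hP, inner_sum]
    refine Finset.sum_eq_zero fun k _ => ?_
    rw [inner_smul_right, ← inner_conj_symm y, hyf _ (hιlt k)]
    simp
  have hyx : ⟪y, x⟫_ℂ = (‖y‖ : ℂ) ^ 2 := by
    have : x = y + P := by rw [hy]; abel
    conv_lhs => rw [this]
    rw [inner_add_right, hyP, add_zero]
    exact inner_self_eq_norm_sq_to_K y
  have hxe : x = ∑ j, ⟪e j, x⟫_ℂ • e j := by
    rw [← Finset.sum_subset (Finset.subset_univ (Finset.univ.map ⟨ι, hιinj⟩))]
    · rw [Finset.sum_map]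
      simp only [Function.Embedding.coeFn_mk, hek]
      exact hx
    · intro j _ hj
      rw [hex j, zero_smul]
      by_contra! hlt
      obtain ⟨k, rfl⟩ := hιex j hlt
      simp at hj
  have hxn : ‖x‖ ^ 2 = ∑ k, ‖w k‖ ^ 2 := by
    have h := (he.comp ι hιinj).norm_sq_sum_smul w
    rw [← h, hx]; rfl
  have hxpos : 0 < ‖x‖ := by
    obtain ⟨k, hk⟩ := Function.ne_iff.1 hw0
    refine norm_pos_iff.2 fun h => hk ?_
    rw [← hek, h, inner_zero_right]; rfl
  have hey : ∀ j : Fin m, (j : ℕ) < r → ⟪e j, y⟫_ℂ = ((1 - q : ℝ) : ℂ) * ⟪e j, x⟫_ℂ := by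
    intro j hj
    obtain ⟨k, rfl⟩ := hιex j hj
    rw [hy, inner_sub_right, hw, hek]
    push_cast
    ring
  have hres := norm_residual_le hrm he hf ha hb ha0 hb0 hΔ hxe hex hyf
    (fun j hj => by rw [hy, inner_sub_right, hPf' j hj, sub_zero]) hyx hey
  have hyn : ‖y‖ ^ 2 = (1 - q) * ‖x‖ ^ 2 := by
    have h : ⟪y, x⟫_ℂ = (((1 - q) * ‖x‖ ^ 2 : ℝ) : ℂ) := by
      conv_lhs => rw [hx]
      rw [inner_sum, hxn, Finset.mul_sum, Complex.ofReal_sum]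
      refine Finset.sum_congr rfl fun k _ => ?_
      rw [inner_smul_right, ← inner_conj_symm y, hey _ (hιlt k), hek, map_mul, Complex.conj_ofReal,
        mul_left_comm, RCLike.mul_conj]
      simp
    rw [hyx] at h
    exact_mod_cast h
  set g := a ⟨r - 1, (Nat.sub_le r 1).trans_lt hrm⟩ - a ⟨r, hrm⟩
  have hg : 0 < g := sub_pos.2 hgap
  have hyB : ‖y‖ ≤ B * ‖x‖ := by
    -- `2 τ ≤ B g < g`, so at least half of the gap survives.
    have h1 : g / 2 * ‖y‖ ≤ (g - τ) * ‖y‖ :=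
      mul_le_mul_of_nonneg_right (by nlinarith) (norm_nonneg y)
    have h2 : τ * ‖x‖ ≤ B * g / 2 * ‖x‖ := mul_le_mul_of_nonneg_right (by linarith) hxpos.le
    have h3 : g / 2 * ‖y‖ ≤ g / 2 * (B * ‖x‖) := by nlinarith
    exact le_of_mul_le_mul_left h3 (by positivity)
  have h4 : (1 - q) * ‖x‖ ^ 2 ≤ B ^ 2 * ‖x‖ ^ 2 := by
    rw [← hyn, ← mul_pow]
    exact pow_le_pow_left₀ (norm_nonneg y) hyB 2
  exact le_of_mul_le_mul_right h4 (by positivity)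

/-! ### From singular value decompositions to spectral forms and canonical angles -/

/-- The `j`-th column of a matrix as a vector of the Euclidean space. -/
noncomputable def colVec {p m : ℕ} (u : Matrix (Fin p) (Fin m) ℂ) (j : Fin m) :
    EuclideanSpace ℂ (Fin p) :=
  WithLp.toLp 2 (fun i => u i j)

theorem inner_colVec {p m : ℕ} (u : Matrix (Fin p) (Fin m) ℂ) (j : Fin m)
    (x : EuclideanSpace ℂ (Fin p)) : ⟪colVec u j, x⟫_ℂ = (uᴴ *ᵥ x.ofLp) j := by
  simp [colVec, EuclideanSpace.inner_eq_star_dotProduct, Matrix.mulVec, dotProduct, mul_comm]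

theorem orthonormal_colVec {p m : ℕ} {u : Matrix (Fin p) (Fin m) ℂ} (hu : uᴴ * u = 1) :
    Orthonormal ℂ (colVec u) := by
  rw [orthonormal_iff_ite]
  intro i j
  rw [inner_colVec]
  have : (uᴴ *ᵥ (colVec u j).ofLp) i = (uᴴ * u) i j := rfl
  rw [this, hu, Matrix.one_apply]

theorem toEuclideanLin_eq_sum_colVec {p m : ℕ} (u : Matrix (Fin p) (Fin m) ℂ)
    (w : EuclideanSpace ℂ (Fin m)) :
    Matrix.toEuclideanLin u w = ∑ j, w j • colVec u j := by
  ext i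
  simp [colVec, Matrix.mulVec, dotProduct, mul_comm, Matrix.toLpLin_apply]

/-- This is `M Mᴴ = u diag(s²) uᴴ` tested on two vectors. In this form the thin decomposition need
not be completed to a basis when `n < p`. -/
theorem IsSVD.inner_conjTranspose {p n : ℕ} {M : Matrix (Fin p) (Fin n) ℂ}
    {s : Fin (min p n) → ℝ} {u : Matrix (Fin p) (Fin (min p n)) ℂ}
    {v : Matrix (Fin n) (Fin (min p n)) ℂ} (h : IsSVD M s u v) (y x : EuclideanSpace ℂ (Fin p)) :
    ⟪Matrix.toEuclideanLin Mᴴ y, Matrix.toEuclideanLin Mᴴ x⟫_ℂ =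
      spectralForm (fun j => s j ^ 2) (colVec u) y x := by
  have hMM : M * Mᴴ = u * Matrix.diagonal (fun j => ((s j ^ 2 : ℝ) : ℂ)) * uᴴ := by
    have hd : (Matrix.diagonal fun j => (s j : ℂ))ᴴ = Matrix.diagonal fun j => (s j : ℂ) := by
      rw [Matrix.diagonal_conjTranspose]
      congr 1
      ext j
      simp
    rw [h.eq_mul]
    simp only [Matrix.conjTranspose_mul, Matrix.conjTranspose_conjTranspose, hd, Matrix.mul_assoc]
    rw [← Matrix.mul_assoc vᴴ v, h.right_orthonormal, Matrix.one_mul,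
      ← Matrix.mul_assoc (Matrix.diagonal _) (Matrix.diagonal _), Matrix.diagonal_mul_diagonal]
    simp [pow_two]
  rw [← LinearMap.adjoint_inner_right, ← Matrix.toEuclideanLin_conjTranspose_eq_adjoint,
    Matrix.conjTranspose_conjTranspose]
  have h1 : Matrix.toEuclideanLin M (Matrix.toEuclideanLin Mᴴ x) =
      Matrix.toEuclideanLin (M * Mᴴ) x := by
    simp [Matrix.toLpLin_apply, Matrix.mulVec_mulVec]
  have h2 : Matrix.toEuclideanLin (M * Mᴴ) x = Matrix.toEuclideanLin u
      (WithLp.toLp 2 fun j => ((s j ^ 2 : ℝ) : ℂ) * ⟪colVec u j, x⟫_ℂ) := by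
    rw [hMM]
    simp only [Matrix.toLpLin_apply, ← Matrix.mulVec_mulVec]
    congr 2
    ext j
    rw [Matrix.mulVec_diagonal, inner_colVec]
  rw [h1, h2, toEuclideanLin_eq_sum_colVec, inner_sum, spectralForm]
  refine Finset.sum_congr rfl fun j _ => ?_
  rw [inner_smul_right]
  ring

/-- The matrix of sines is diagonal, so each angle can be treated alone: `sin (arccos σ_k) = √(1 -
σ_k²)`, and `σ_k²` is an eigenvalue of `(Ûᴴ U)ᴴ (Ûᴴ U)`, whose eigenvector provides the test vector.
-/
theorem subspaceDist_le {p n r : ℕ} (hrpn : r < min p n)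
    {M Mhat : Matrix (Fin p) (Fin n) ℂ} {s shat : Fin (min p n) → ℝ}
    {u uhat : Matrix (Fin p) (Fin (min p n)) ℂ} {v vhat : Matrix (Fin n) (Fin (min p n)) ℂ}
    (hM : IsSVD M s u v) (hMhat : IsSVD Mhat shat uhat vhat)
    (hgap : s ⟨r, hrpn⟩ < s ⟨r - 1, (Nat.sub_le r 1).trans_lt hrpn⟩) {c τ B : ℝ}
    (hΔ : ∀ y x, ‖⟪Matrix.toEuclideanLin Mhatᴴ y, Matrix.toEuclideanLin Mhatᴴ x⟫_ℂ
      - ⟪Matrix.toEuclideanLin Mᴴ y, Matrix.toEuclideanLin Mᴴ x⟫_ℂ - c * ⟪y, x⟫_ℂ‖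
        ≤ τ * ‖y‖ * ‖x‖) (hB0 : 0 ≤ B) (hB1 : B < 1)
    (hτ : 2 * τ ≤ B * (s ⟨r - 1, (Nat.sub_le r 1).trans_lt hrpn⟩ ^ 2 - s ⟨r, hrpn⟩ ^ 2)) :
    subspaceDist (firstCols hrpn.le uhat) (firstCols hrpn.le u) ≤ B := by
  rw [subspaceDist, Matrix.l2_opNorm_diagonal, pi_norm_le_iff_of_nonneg hB0]
  intro k
  rw [canonicalAngle, Real.sin_arccos]
  set U := firstCols hrpn.le u
  set V := firstCols hrpn.le uhat
  set T := Matrix.toEuclideanLin (Vᴴ * U)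
  rw [Real.norm_of_nonneg (Real.sqrt_nonneg _)]
  refine Real.sqrt_le_iff.2 ⟨hB0, ?_⟩
  obtain ⟨w, hw, hw0⟩ := (T.hasEigenvalue_adjoint_comp_self_sq_singularValues
    (n := k) (by simp)).exists_hasEigenvector
  rw [Module.End.mem_eigenspace_iff] at hw
  have hanti : ∀ {t : Fin (min p n) → ℝ}, Antitone t → (∀ j, 0 ≤ t j) →
      Antitone fun j => t j ^ 2 := fun h h0 i j hij => pow_le_pow_left₀ (h0 _) (h hij) 2
  have hxU : Matrix.toEuclideanLin U w = ∑ l, w l • colVec u (l.castLE hrpn.le) :=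
    toEuclideanLin_eq_sum_colVec U w
  refine norm_sq_residual_le (a := fun j => s j ^ 2) (b := fun j => shat j ^ 2)
    (e := colVec u) (f := colVec uhat) (w := w.ofLp) hrpn
    (orthonormal_colVec hM.left_orthonormal) (orthonormal_colVec hMhat.left_orthonormal)
    (hanti hM.antitone hM.nonneg) (hanti hMhat.antitone hMhat.nonneg) (fun _ => sq_nonneg _)
    (fun _ => sq_nonneg _) (c := c) (τ := τ) ?_ hB1
    (pow_lt_pow_left₀ hgap (hM.nonneg _) two_ne_zero) hτ ?_ hxU ?_
  · intro y x
    rw [← hM.inner_conjTranspose, ← hMhat.inner_conjTranspose]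
    exact hΔ y x
  · intro h
    exact hw0 (by ext i; exact congrFun h i)
  · intro i
    have h1 : ∀ l : Fin r, ⟪colVec uhat (l.castLE hrpn.le), Matrix.toEuclideanLin U w⟫_ℂ =
        T w l := by
      intro l
      rw [inner_colVec]
      simp only [T, Matrix.toLpLin_apply, ← Matrix.mulVec_mulVec]
      rfl
    simp only [h1]
    have h2 : ∑ l : Fin r, T w l • colVec uhat (l.castLE hrpn.le) =
        Matrix.toEuclideanLin V (T w) := (toEuclideanLin_eq_sum_colVec V _).symm
    rw [h2, inner_colVec]
    have h3 := congrArg (fun z : EuclideanSpace ℂ (Fin r) => z i) hw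
    rw [LinearMap.comp_apply, ← Matrix.toEuclideanLin_conjTranspose_eq_adjoint,
      Matrix.conjTranspose_mul, Matrix.conjTranspose_conjTranspose] at h3
    simp only [Matrix.toLpLin_apply, ← Matrix.mulVec_mulVec] at h3 ⊢
    refine Eq.trans ?_ (h3.trans ?_)
    · rfl
    · simp

/-! ### The complex Gaussian law: invariance, exponential moments, tail -/

instance isProbabilityMeasure_complexGaussian (v : ℝ≥0) :
    IsProbabilityMeasure (complexGaussian v) :=
  Measure.isProbabilityMeasure_map (by fun_prop)

theorem lintegral_complexGaussian (v : ℝ≥0) {f : ℂ → ℝ≥0∞} (hf : Measurable f) :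
    ∫⁻ z, f z ∂complexGaussian v =
      ∫⁻ q : ℝ × ℝ, f ⟨q.1, q.2⟩ ∂((gaussianReal 0 (v / 2)).prod (gaussianReal 0 (v / 2))) := by
  rw [complexGaussian, lintegral_map hf (by fun_prop)]
  rfl

theorem charFun_complexGaussian (v : ℝ≥0) (t : ℂ) :
    charFun (complexGaussian v) t = Complex.exp (-(v * (‖t‖ ^ 2 : ℝ) / 4 : ℝ)) := by
  rw [charFun_apply, complexGaussian, integral_map_equiv]
  have h : ∀ q : ℝ × ℝ, Complex.exp (⟪Complex.measurableEquivRealProd.symm q, t⟫_ℝ * Complex.I) =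
      Complex.exp (t.re * q.1 * Complex.I) * Complex.exp (t.im * q.2 * Complex.I) := by
    intro q
    rw [← Complex.exp_add]
    congr 1
    rw [Complex.inner]
    simp [Complex.measurableEquivRealProd_symm_apply]
    ring
  simp_rw [h]
  rw [integral_prod_mul (fun x : ℝ => Complex.exp (t.re * x * Complex.I))
    (fun x : ℝ => Complex.exp (t.im * x * Complex.I)), ← charFun_apply_real, ← charFun_apply_real,
    charFun_gaussianReal, charFun_gaussianReal, ← Complex.exp_add]
  congr 1
  rw [← Complex.normSq_eq_norm_sq, Complex.normSq_apply]
  push_cast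
  ring

theorem ofReal_sum_norm_sq {ι : Type*} [Fintype ι] (z : ι → ℂ) :
    ((∑ i, ‖z i‖ ^ 2 : ℝ) : ℂ) = star z ⬝ᵥ z := by
  simp [dotProduct, Complex.conj_mul']

/-- A linear map with orthonormal rows takes white complex Gaussian noise to white noise. -/
theorem map_mulVec_pi_complexGaussian {ι κ : Type*} [Fintype ι] [Fintype κ] [DecidableEq κ]
    (v : ℝ≥0) (A : Matrix κ ι ℂ) (hA : A * Aᴴ = 1) :
    (Measure.pi fun _ : ι => complexGaussian v).map (fun x => A *ᵥ x) =
      Measure.pi fun _ : κ => complexGaussian v := by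
  have hmeas : Measurable fun x : ι → ℂ => A *ᵥ x := by
    unfold Matrix.mulVec dotProduct
    fun_prop
  have : IsProbabilityMeasure
      ((Measure.pi fun _ : ι => complexGaussian v).map (fun x => A *ᵥ x)) :=
    Measure.isProbabilityMeasure_map hmeas.aemeasurable
  rw [← charFun_eq_pi_iff]
  intro t
  -- The white-noise characteristic function depends only on the norm of its argument, and `Aᴴ` is
  -- an isometry.
  have hadj : ∀ x : ι → ℂ, ⟪WithLp.toLp 2 (A *ᵥ x), t⟫_ℝ =
      ⟪WithLp.toLp 2 x, (WithLp.toLp 2 (Aᴴ *ᵥ t.ofLp) : PiLp 2 fun _ : ι => ℂ)⟫_ℝ := by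
    intro x
    have h : star (A *ᵥ x) ⬝ᵥ t.ofLp = star x ⬝ᵥ (Aᴴ *ᵥ t.ofLp) := by
      rw [Matrix.star_mulVec, Matrix.dotProduct_mulVec]
    have h' := congrArg Complex.re h
    simp only [dotProduct, Complex.re_sum, Pi.star_apply] at h'
    simp only [PiLp.inner_apply, Complex.inner]
    simpa [mul_comm] using h'
  have hnorm : ∑ i, ‖(Aᴴ *ᵥ t.ofLp) i‖ ^ 2 = ∑ k, ‖t.ofLp k‖ ^ 2 := by
    have : ((∑ i, ‖(Aᴴ *ᵥ t.ofLp) i‖ ^ 2 : ℝ) : ℂ) = ((∑ k, ‖t.ofLp k‖ ^ 2 : ℝ) : ℂ) := by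
      rw [ofReal_sum_norm_sq, ofReal_sum_norm_sq, Matrix.star_mulVec,
        Matrix.conjTranspose_conjTranspose, Matrix.dotProduct_mulVec, Matrix.vecMul_vecMul, hA,
        Matrix.vecMul_one]
    exact_mod_cast this
  have hmeas2 : Measurable (WithLp.toLp 2 : (κ → ℂ) → PiLp 2 fun _ : κ => ℂ) := by fun_prop
  rw [Measure.map_map hmeas2 hmeas, charFun_apply,
    integral_map (hmeas2.comp hmeas).aemeasurable (by fun_prop)]
  simp only [Function.comp_apply, hadj]
  have hpi := charFun_pi (μ := fun _ : ι => complexGaussian v)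
    (WithLp.toLp 2 (Aᴴ *ᵥ t.ofLp) : PiLp 2 fun _ : ι => ℂ)
  rw [charFun_apply, integral_map (by fun_prop) (by fun_prop)] at hpi
  rw [hpi]
  simp only [charFun_complexGaussian, ← Complex.exp_sum, ← Complex.ofReal_neg,
    ← Complex.ofReal_sum]
  congr 2
  simp only [Finset.sum_neg_distrib, ← Finset.sum_div, ← Finset.mul_sum, hnorm]

/-- Completing the square: the tilted density is a constant times a Gaussian density of variance `w
/ (1 - 2 w θ)`. -/
theorem lintegral_exp_sq_gaussianReal {w : ℝ≥0} (hw : w ≠ 0) {θ : ℝ} (hθ : 2 * w * θ < 1)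
    (a : ℝ) :
    ∫⁻ x, ENNReal.ofReal (Real.exp (θ * ((a + x) ^ 2 - a ^ 2))) ∂gaussianReal 0 w =
      ENNReal.ofReal ((√(1 - 2 * w * θ))⁻¹ *
        Real.exp (2 * w * θ ^ 2 * a ^ 2 / (1 - 2 * w * θ))) := by
  set d := 1 - 2 * w * θ with hd
  have hd0 : 0 < d := by linarith
  have hw0 : 0 < (w : ℝ) := by positivity
  obtain ⟨w', hw'⟩ : ∃ w' : ℝ≥0, (w' : ℝ) = w / d := ⟨⟨w / d, by positivity⟩, rfl⟩
  have hw'0 : w' ≠ 0 := by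
    intro h
    rw [h] at hw'
    have : 0 < (w : ℝ) / d := by positivity
    rw [← hw'] at this
    exact this.ne' rfl
  set C := (√d)⁻¹ * Real.exp (2 * w * θ ^ 2 * a ^ 2 / d)
  have hpdf : ∀ x, gaussianPDFReal 0 w x * Real.exp (θ * ((a + x) ^ 2 - a ^ 2)) =
      C * gaussianPDFReal (2 * a * θ * w') w' x := by
    intro x
    have hsq : √(2 * Real.pi * w) = √d * √(2 * Real.pi * w') := by
      rw [← Real.sqrt_mul hd0.le, hw']
      congr 1
      field_simp
    have hwd : (w' : ℝ) * d = w := by rw [hw']; field_simp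
    simp only [gaussianPDFReal, C]
    rw [hsq, mul_inv, mul_assoc, ← Real.exp_add,
      mul_mul_mul_comm, ← Real.exp_add]
    congr 2
    have hw'1 : (w' : ℝ) ≠ 0 := by exact_mod_cast hw'0
    rw [← hwd]
    have e : θ = (1 - d) / (2 * w) := by rw [hd]; field_simp; ring
    rw [e, ← hwd]
    field_simp
    ring
  rw [gaussianReal_of_var_ne_zero _ hw, lintegral_withDensity_eq_lintegral_mul _
    (measurable_gaussianPDF _ _) (by fun_prop)]
  have : ∀ x, (gaussianPDF 0 w * fun x =>
      ENNReal.ofReal (Real.exp (θ * ((a + x) ^ 2 - a ^ 2)))) x =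
      ENNReal.ofReal C * gaussianPDF (2 * a * θ * w') w' x := by
    intro x
    rw [Pi.mul_apply, gaussianPDF, gaussianPDF,
      ← ENNReal.ofReal_mul (gaussianPDFReal_nonneg _ _ _), hpdf,
      ENNReal.ofReal_mul (by positivity)]
  simp_rw [this]
  rw [lintegral_const_mul _ (measurable_gaussianPDF _ _), lintegral_gaussianPDF_eq_one _ hw'0,
    mul_one]

/-- Real and imaginary parts are independent of variance `v / 2`, so this is a product of two real
moments, and the two square roots merge. -/
theorem lintegral_exp_normSq_complexGaussian {v : ℝ≥0} (hv : v ≠ 0) {θ : ℝ} (hθ : v * θ < 1)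
    (a : ℂ) :
    ∫⁻ z, ENNReal.ofReal (Real.exp (θ * (‖a + z‖ ^ 2 - ‖a‖ ^ 2))) ∂complexGaussian v =
      ENNReal.ofReal ((1 - v * θ)⁻¹ * Real.exp (v * θ ^ 2 * ‖a‖ ^ 2 / (1 - v * θ))) := by
  have hw : v / 2 ≠ 0 := by positivity
  have hvw : 2 * ((v / 2 : ℝ≥0) : ℝ) = v := by push_cast; ring
  have hθ' : 2 * ((v / 2 : ℝ≥0) : ℝ) * θ < 1 := by rwa [hvw]
  rw [lintegral_complexGaussian _ (by fun_prop)]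
  have hsplit : ∀ q : ℝ × ℝ,
      ENNReal.ofReal (Real.exp (θ * (‖a + (⟨q.1, q.2⟩ : ℂ)‖ ^ 2 - ‖a‖ ^ 2))) =
      ENNReal.ofReal (Real.exp (θ * ((a.re + q.1) ^ 2 - a.re ^ 2))) *
      ENNReal.ofReal (Real.exp (θ * ((a.im + q.2) ^ 2 - a.im ^ 2))) := by
    intro q
    rw [← ENNReal.ofReal_mul (by positivity), ← Real.exp_add, ← Complex.normSq_eq_norm_sq,
      ← Complex.normSq_eq_norm_sq, Complex.normSq_apply, Complex.normSq_apply]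
    congr 2
    simp only [Complex.add_re, Complex.add_im]
    ring
  simp_rw [hsplit]
  rw [lintegral_prod_mul (f := fun x => ENNReal.ofReal
      (Real.exp (θ * ((a.re + x) ^ 2 - a.re ^ 2))))
    (g := fun x => ENNReal.ofReal (Real.exp (θ * ((a.im + x) ^ 2 - a.im ^ 2))))
    (by fun_prop) (by fun_prop), lintegral_exp_sq_gaussianReal hw hθ',
    lintegral_exp_sq_gaussianReal hw hθ', hvw, ← ENNReal.ofReal_mul (by positivity)]
  congr 1
  have hd : 0 < 1 - v * θ := by linarith
  rw [mul_mul_mul_comm, ← mul_inv, Real.mul_self_sqrt hd.le, ← Real.exp_add,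
    ← Complex.normSq_eq_norm_sq, Complex.normSq_apply]
  congr 2
  ring

/-- The squared modulus is a standard exponential variable. In polar coordinates the density `π⁻¹
exp (-r²)` has the elementary radial primitive `-(2π)⁻¹ exp (-r²)`, and the angle contributes `2π`.
-/
theorem le_complexGaussian_one_tail {t : ℝ} (ht : 0 ≤ t) :
    ENNReal.ofReal (Real.exp (-t)) ≤ complexGaussian 1 {z | z ≠ 0 ∧ t ≤ ‖z‖ ^ 2} := by
  have hS : MeasurableSet {z : ℂ | z ≠ 0 ∧ t ≤ ‖z‖ ^ 2} :=
    (measurableSet_singleton (0 : ℂ)).compl.inter (measurableSet_le measurable_const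
      (measurable_norm.pow_const 2))
  have hhalf : (1 / 2 : ℝ≥0) ≠ 0 := by positivity
  have hG : Measurable fun q : ℝ × ℝ =>
      {z : ℂ | z ≠ 0 ∧ t ≤ ‖z‖ ^ 2}.indicator (1 : ℂ → ℝ≥0∞) ⟨q.1, q.2⟩ :=
    (measurable_one.indicator hS).comp Complex.measurableEquivRealProd.symm.measurable
  rw [← lintegral_indicator_one hS, lintegral_complexGaussian _
    (measurable_one.indicator hS), gaussianReal_of_var_ne_zero _ hhalf,
    prod_withDensity (measurable_gaussianPDF _ _) (measurable_gaussianPDF _ _),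
    lintegral_withDensity_eq_lintegral_mul _ (by fun_prop) hG,
    ← Measure.volume_eq_prod, ← lintegral_comp_polarCoord_symm]
  have hderiv : ∀ x ∈ Set.Ici (√t), HasDerivAt (fun r : ℝ => -(2 * Real.pi)⁻¹ * Real.exp (-r ^ 2))
      (x * (Real.pi⁻¹ * Real.exp (-x ^ 2))) x := by
    intro x _
    have h := (((hasDerivAt_pow 2 x).fun_neg).exp).const_mul (-(2 * Real.pi)⁻¹)
    refine h.congr_deriv ?_
    have := Real.pi_ne_zero
    push_cast
    field_simp
  have hnn : ∀ x ∈ Set.Ioi (√t), 0 ≤ x * (Real.pi⁻¹ * Real.exp (-x ^ 2)) := fun x hx => by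
    have : 0 ≤ x := (Real.sqrt_nonneg t).trans (le_of_lt hx)
    positivity
  have hlim : Filter.Tendsto (fun r : ℝ => -(2 * Real.pi)⁻¹ * Real.exp (-r ^ 2)) Filter.atTop
      (nhds (-(2 * Real.pi)⁻¹ * 0)) := by
    refine Filter.Tendsto.const_mul _ (Real.tendsto_exp_neg_atTop_nhds_zero.comp ?_)
    exact Filter.tendsto_pow_atTop two_ne_zero
  have hint : ∫ x in Set.Ioi (√t), x * (Real.pi⁻¹ * Real.exp (-x ^ 2)) =
      (2 * Real.pi)⁻¹ * Real.exp (-t) := by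
    rw [integral_Ioi_of_hasDerivAt_of_nonneg' hderiv hnn hlim, Real.sq_sqrt ht]
    ring
  have hint' : ∫⁻ x in Set.Ioi (√t), ENNReal.ofReal (x * (Real.pi⁻¹ * Real.exp (-x ^ 2))) =
      ENNReal.ofReal ((2 * Real.pi)⁻¹ * Real.exp (-t)) := by
    rw [← hint, ofReal_integral_eq_lintegral_ofReal]
    · exact integrableOn_Ioi_deriv_of_nonneg' hderiv hnn hlim
    · exact (ae_restrict_iff' measurableSet_Ioi).2 (ae_of_all _ hnn)
  have hsub : Set.Ioi (√t) ×ˢ Set.Ioo (-Real.pi) Real.pi ⊆ polarCoord.target :=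
    Set.prod_mono (Set.Ioi_subset_Ioi (Real.sqrt_nonneg t)) subset_rfl
  refine le_trans ?_ (lintegral_mono_set hsub)
  have hcongr : ∀ q ∈ Set.Ioi (√t) ×ˢ Set.Ioo (-Real.pi) Real.pi,
      ENNReal.ofReal (q.1 * (Real.pi⁻¹ * Real.exp (-q.1 ^ 2))) * 1 ≤ ENNReal.ofReal q.1 •
        ((fun z : ℝ × ℝ => gaussianPDF 0 (1 / 2) z.1 * gaussianPDF 0 (1 / 2) z.2) *
          fun q : ℝ × ℝ => {z : ℂ | z ≠ 0 ∧ t ≤ ‖z‖ ^ 2}.indicator (1 : ℂ → ℝ≥0∞) ⟨q.1, q.2⟩ :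
            ℝ × ℝ → ℝ≥0∞) (polarCoord.symm q) := by
    intro q hq
    have hq1 : √t < q.1 := hq.1
    have hq0 : 0 < q.1 := (Real.sqrt_nonneg t).trans_lt hq1
    have hns : ‖(⟨q.1 * Real.cos q.2, q.1 * Real.sin q.2⟩ : ℂ)‖ ^ 2 = q.1 ^ 2 := by
      rw [← Complex.normSq_eq_norm_sq, Complex.normSq_apply]
      have := Real.sin_sq_add_cos_sq q.2
      simp only
      linear_combination q.1 ^ 2 * this
    have hmem : (⟨q.1 * Real.cos q.2, q.1 * Real.sin q.2⟩ : ℂ) ∈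
        {z : ℂ | z ≠ 0 ∧ t ≤ ‖z‖ ^ 2} := by
      refine ⟨fun h => ?_, ?_⟩
      · rw [h] at hns
        rw [norm_zero] at hns
        nlinarith
      · rw [hns]
        exact (Real.sqrt_le_left hq0.le).1 hq1.le
    have hpdf : gaussianPDFReal 0 (1 / 2) (q.1 * Real.cos q.2) *
        gaussianPDFReal 0 (1 / 2) (q.1 * Real.sin q.2) = Real.pi⁻¹ * Real.exp (-q.1 ^ 2) := by
      simp only [gaussianPDFReal]
      rw [mul_mul_mul_comm, ← mul_inv, Real.mul_self_sqrt (by positivity), ← Real.exp_add]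
      have := Real.sin_sq_add_cos_sq q.2
      congr 2
      · push_cast
        ring
      · simp only [NNReal.coe_div, NNReal.coe_one, NNReal.coe_ofNat]
        linear_combination (-q.1 ^ 2) * this
    rw [polarCoord_symm_apply, Pi.mul_apply, Set.indicator_of_mem hmem, gaussianPDF, gaussianPDF,
      ← ENNReal.ofReal_mul (gaussianPDFReal_nonneg _ _ _), hpdf, Pi.one_apply, mul_one, mul_one,
      smul_eq_mul, ENNReal.ofReal_mul hq0.le]
  refine le_trans (le_of_eq ?_) (setLIntegral_mono' (by measurability) hcongr)
  rw [Measure.volume_eq_prod, ← Measure.prod_restrict, lintegral_prod_mul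
    (f := fun r : ℝ => ENNReal.ofReal (r * (Real.pi⁻¹ * Real.exp (-r ^ 2)))) (g := fun _ => 1)
    (by fun_prop) (by fun_prop), hint', lintegral_one, Measure.restrict_apply_univ,
    Real.volume_Ioo, ← ENNReal.ofReal_mul (by positivity)]
  congr 1
  field_simp
  ring

/-! ### Gaussian mass of a cone -/

theorem lintegral_pi_prod_eq_prod {ι : Type*} [Fintype ι] (μ : Measure ℂ) [IsProbabilityMeasure μ]
    {f : ι → ℂ → ℝ≥0∞} (hf : ∀ i, Measurable (f i)) :
    ∫⁻ x, ∏ i, f i (x i) ∂(Measure.pi fun _ : ι => μ) = ∏ i, ∫⁻ z, f i z ∂μ := by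
  rw [lintegral_prod_eq_prod_lintegral_of_indepFun Finset.univ
    (fun i (x : ι → ℂ) => f i (x i)) (iIndepFun_pi fun i => (hf i).aemeasurable)
    fun i => (hf i).comp (measurable_pi_apply i)]
  exact Finset.prod_congr rfl fun i _ =>
    (measurePreserving_eval (fun _ : ι => μ) i).lintegral_comp (hf i)

/-- With `κ = (1 - η) / η`, the cone condition says that `‖y 0‖²` is at least `κ` times the sum of
the other `‖y i‖²`. Conditionally on these, the exponential tail gives `∏ exp (-κ ‖y i‖²)`, whose
mean is `(1 + κ)^(-k) = η^k`. -/
theorem le_pi_complexGaussian_cone_zero (k : ℕ) {η : ℝ} (hη0 : 0 < η) (hη1 : η < 1) :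
    ENNReal.ofReal (η ^ k) ≤ (Measure.pi fun _ : Fin (k + 1) => complexGaussian 1)
      {y | y 0 ≠ 0 ∧ (1 - η) * ∑ i, ‖y i‖ ^ 2 ≤ ‖y 0‖ ^ 2} := by
  set κ := (1 - η) / η with hκ
  have hκ0 : 0 < κ := div_pos (by linarith) hη0
  have hmp := measurePreserving_piFinSuccAbove (fun _ : Fin (k + 1) => complexGaussian 1) 0
  set S : Set (ℂ × (Fin k → ℂ)) := {q | q.1 ≠ 0 ∧ κ * ∑ i, ‖q.2 i‖ ^ 2 ≤ ‖q.1‖ ^ 2} with hS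
  have hSm : MeasurableSet S := by
    have h1 : MeasurableSet {q : ℂ × (Fin k → ℂ) | q.1 ≠ 0} :=
      measurable_fst (measurableSet_singleton (0 : ℂ)).compl
    have h2 : MeasurableSet {q : ℂ × (Fin k → ℂ) | κ * ∑ i, ‖q.2 i‖ ^ 2 ≤ ‖q.1‖ ^ 2} :=
      measurableSet_le (by fun_prop) (by fun_prop)
    exact h1.inter h2
  have hset : {y : Fin (k + 1) → ℂ | y 0 ≠ 0 ∧ (1 - η) * ∑ i, ‖y i‖ ^ 2 ≤ ‖y 0‖ ^ 2} =
      MeasurableEquiv.piFinSuccAbove (fun _ => ℂ) 0 ⁻¹' S := by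
    ext y
    simp only [hS, Set.mem_ofPred_eq, Set.mem_preimage, MeasurableEquiv.piFinSuccAbove_apply,
      Fin.insertNthEquiv_symm_apply, Fin.sum_univ_succ, Fin.removeNth, Fin.zero_succAbove]
    refine and_congr_right fun _ => ?_
    rw [hκ, div_mul_eq_mul_div, div_le_iff₀ hη0]
    constructor <;> intro h <;> linarith
  rw [hset, hmp.measure_preimage hSm.nullMeasurableSet, Measure.prod_apply_symm hSm]
  calc ENNReal.ofReal (η ^ k)
      = ∏ _i : Fin k, ENNReal.ofReal η := by
        rw [Finset.prod_const, Finset.card_univ, Fintype.card_fin, ENNReal.ofReal_pow hη0.le]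
    _ = ∏ _i : Fin k, ∫⁻ z, ENNReal.ofReal (Real.exp (-κ * (‖(0 : ℂ) + z‖ ^ 2 - ‖(0 : ℂ)‖ ^ 2)))
          ∂complexGaussian 1 := by
        refine Finset.prod_congr rfl fun _ _ => ?_
        rw [lintegral_exp_normSq_complexGaussian one_ne_zero
          (by rw [NNReal.coe_one]; linarith)]
        congr 1
        rw [hκ]
        simp
        field_simp
        ring
    _ = ∫⁻ y : Fin k → ℂ, ∏ i, ENNReal.ofReal
          (Real.exp (-κ * (‖(0 : ℂ) + y i‖ ^ 2 - ‖(0 : ℂ)‖ ^ 2)))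
          ∂(Measure.pi fun _ : Fin k => complexGaussian 1) := by
        rw [lintegral_pi_prod_eq_prod (complexGaussian 1) (f := fun _ z => ENNReal.ofReal
          (Real.exp (-κ * (‖(0 : ℂ) + z‖ ^ 2 - ‖(0 : ℂ)‖ ^ 2)))) fun i => by fun_prop]
    _ ≤ _ := by
        refine lintegral_mono fun y => ?_
        have hexp : ∏ i, ENNReal.ofReal
            (Real.exp (-κ * (‖(0 : ℂ) + y i‖ ^ 2 - ‖(0 : ℂ)‖ ^ 2))) =
            ENNReal.ofReal (Real.exp (-(κ * ∑ i, ‖y i‖ ^ 2))) := by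
          rw [← ENNReal.ofReal_prod_of_nonneg fun _ _ => (Real.exp_pos _).le, ← Real.exp_sum]
          simp [Finset.mul_sum]
        rw [hexp]
        exact le_complexGaussian_one_tail (by positivity)

/-- The mass that white complex Gaussian noise gives to a cone around a unit vector. -/
theorem le_pi_complexGaussian_cone {p : ℕ} (hp : 0 < p) {η : ℝ} (hη0 : 0 < η) (hη1 : η < 1)
    {e : EuclideanSpace ℂ (Fin p)} (he : ‖e‖ = 1) :
    ENNReal.ofReal (η ^ p) ≤ (Measure.pi fun _ : Fin p => complexGaussian 1)
      {x | x ≠ 0 ∧ (1 - η) * ‖WithLp.toLp 2 x‖ ^ 2 ≤ ‖⟪e, WithLp.toLp 2 x⟫_ℂ‖ ^ 2} := by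
  obtain ⟨k, rfl⟩ : ∃ k, p = k + 1 := ⟨p - 1, by omega⟩
  -- A unitary change of coordinates that sends `e` to the first basis vector preserves the noise.
  obtain ⟨b, hb⟩ := Orthonormal.exists_orthonormalBasis_extension_of_card_eq (𝕜 := ℂ)
    (ι := Fin (k + 1)) (E := EuclideanSpace ℂ (Fin (k + 1))) (by simp)
    (v := fun _ => e) (s := {0}) (by
      refine ⟨fun _ => he, fun i j hij => absurd (Subsingleton.elim i j) hij⟩)
  have hb0 : b 0 = e := hb 0 rfl
  set A : Matrix (Fin (k + 1)) (Fin (k + 1)) ℂ := fun i j => star (b i j)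
  have hAx : ∀ (x : Fin (k + 1) → ℂ) i, (A *ᵥ x) i = ⟪b i, WithLp.toLp 2 x⟫_ℂ := by
    intro x i
    simp [A, Matrix.mulVec, dotProduct, PiLp.inner_apply, mul_comm]
  have hA : A * Aᴴ = 1 := by
    ext i j
    have := hAx (b j).ofLp i
    rw [Matrix.mul_apply, Matrix.one_apply]
    refine Eq.trans ?_ (this.trans (orthonormal_iff_ite.1 b.orthonormal i j))
    have hAH : ∀ k, Aᴴ k j = b j k := fun k => by
      rw [Matrix.conjTranspose_apply]
      exact star_star _
    simp only [hAH]
    rfl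
  have hmeas : Measurable fun x : Fin (k + 1) → ℂ => A *ᵥ x := by
    unfold Matrix.mulVec dotProduct
    fun_prop
  have hSm : MeasurableSet
      {y : Fin (k + 1) → ℂ | y 0 ≠ 0 ∧ (1 - η) * ∑ i, ‖y i‖ ^ 2 ≤ ‖y 0‖ ^ 2} := by
    have h1 : MeasurableSet {y : Fin (k + 1) → ℂ | y 0 ≠ 0} :=
      measurable_pi_apply (X := fun _ => ℂ) 0 (measurableSet_singleton (0 : ℂ)).compl
    have h2 : MeasurableSet
        {y : Fin (k + 1) → ℂ | (1 - η) * ∑ i, ‖y i‖ ^ 2 ≤ ‖y 0‖ ^ 2} :=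
      measurableSet_le (by fun_prop) (by fun_prop)
    exact h1.inter h2
  have h := le_pi_complexGaussian_cone_zero k hη0 hη1
  rw [← map_mulVec_pi_complexGaussian 1 A hA, Measure.map_apply hmeas hSm] at h
  refine le_trans (ENNReal.ofReal_le_ofReal ?_) (h.trans (measure_mono ?_))
  -- The mass found is `η^(p-1)`; the weaker `η^p` is all that is used later.
  · exact pow_le_pow_of_le_one hη0.le hη1.le k.le_succ
  · rintro x ⟨hx0, hx⟩
    simp only [hAx, hb0] at hx0 hx
    refine ⟨?_, ?_⟩
    · rintro rfl
      simp at hx0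
    · rwa [b.sum_sq_norm_inner_right] at hx

/-! ### From the operator norm to the quadratic form -/

/-- Either a symmetric operator is bounded by `τ`, or its quadratic form is large on a cone. -/
theorem LinearMap.IsSymmetric.norm_le_or_exists_cone {H : Type*} [NormedAddCommGroup H]
    [InnerProductSpace ℂ H] [FiniteDimensional ℂ H] {T : H →ₗ[ℂ] H} (hT : T.IsSymmetric)
    {τ η : ℝ} (hτ : 0 ≤ τ) (hη : 2 * η ≤ 1) :
    (∀ x, ‖T x‖ ≤ τ * ‖x‖) ∨ ∃ e : H, ‖e‖ = 1 ∧
      ((∀ x, (1 - η) * ‖x‖ ^ 2 ≤ ‖⟪e, x⟫_ℂ‖ ^ 2 →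
          (1 - 2 * η) * τ * ‖x‖ ^ 2 ≤ (⟪x, T x⟫_ℂ).re) ∨
        ∀ x, (1 - η) * ‖x‖ ^ 2 ≤ ‖⟪e, x⟫_ℂ‖ ^ 2 →
          (1 - 2 * η) * τ * ‖x‖ ^ 2 ≤ -(⟪x, T x⟫_ℂ).re) := by
  set b := hT.eigenvectorBasis rfl
  set l := hT.eigenvalues rfl
  have hTb : ∀ x i, ⟪b i, T x⟫_ℂ = l i * ⟪b i, x⟫_ℂ := by
    intro x i
    rw [← b.repr_apply_apply, ← b.repr_apply_apply]
    exact hT.eigenvectorBasis_apply_self_apply rfl x i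
  have hquad : ∀ x, (⟪x, T x⟫_ℂ).re = ∑ i, l i * ‖⟪b i, x⟫_ℂ‖ ^ 2 := by
    intro x
    rw [← b.sum_inner_mul_inner, Complex.re_sum]
    refine Finset.sum_congr rfl fun i _ => ?_
    rw [hTb, mul_left_comm, inner_mul_inner_swap, ← Complex.ofReal_mul, Complex.ofReal_re]
  by_cases hall : ∀ i, |l i| ≤ τ
  · left
    intro x
    refine le_of_sq_le_sq ?_ (by positivity)
    rw [← b.sum_sq_norm_inner_right (T x), mul_pow, ← b.sum_sq_norm_inner_right x, Finset.mul_sum]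
    refine Finset.sum_le_sum fun i _ => ?_
    rw [hTb, norm_mul, mul_pow, Complex.norm_real, Real.norm_eq_abs]
    have := hall i
    gcongr
  · right
    push Not at hall
    obtain ⟨i₀, hi₀⟩ := hall
    obtain ⟨i, -, hi⟩ := Finset.exists_max_image Finset.univ (fun i => |l i|) ⟨i₀, Finset.mem_univ _⟩
    have hτi : τ ≤ |l i| := hi₀.le.trans (hi i₀ (Finset.mem_univ _))
    have hmain : ∀ (g : Fin _ → ℝ), (∀ j, -|l i| ≤ g j) → g i = |l i| → ∀ x,
        (1 - η) * ‖x‖ ^ 2 ≤ ‖⟪b i, x⟫_ℂ‖ ^ 2 →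
        (1 - 2 * η) * τ * ‖x‖ ^ 2 ≤ ∑ j, g j * ‖⟪b j, x⟫_ℂ‖ ^ 2 := by
      intro g hg hgi x hx
      -- The coordinate `i` contributes `|l i|` and every other one at least `-|l i|`; on the cone
      -- this leaves `(1 - η) - η = 1 - 2 η`.
      have h1 : 2 * |l i| * ‖⟪b i, x⟫_ℂ‖ ^ 2 - |l i| * ‖x‖ ^ 2 ≤
          ∑ j, g j * ‖⟪b j, x⟫_ℂ‖ ^ 2 := by
        rw [← b.sum_sq_norm_inner_right x, ← Finset.add_sum_erase _ _ (Finset.mem_univ i),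
          ← Finset.add_sum_erase _ (fun j => g j * ‖⟪b j, x⟫_ℂ‖ ^ 2) (Finset.mem_univ i), hgi,
          mul_add, Finset.mul_sum]
        have h2 : -∑ j ∈ Finset.univ.erase i, |l i| * ‖⟪b j, x⟫_ℂ‖ ^ 2 ≤
            ∑ j ∈ Finset.univ.erase i, g j * ‖⟪b j, x⟫_ℂ‖ ^ 2 := by
          rw [← Finset.sum_neg_distrib]
          refine Finset.sum_le_sum fun j _ => ?_
          rw [← neg_mul]
          exact mul_le_mul_of_nonneg_right (hg j) (by positivity)
        linarith
      have h3 : (1 - 2 * η) * τ * ‖x‖ ^ 2 ≤ (1 - 2 * η) * |l i| * ‖x‖ ^ 2 := by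
        have : 0 ≤ 1 - 2 * η := by linarith
        gcongr
      nlinarith [mul_le_mul_of_nonneg_left hx (abs_nonneg (l i))]
    refine ⟨b i, b.orthonormal.1 i, ?_⟩
    have hbd : ∀ j, |l j| ≤ |l i| := fun j => hi j (Finset.mem_univ _)
    rcases abs_choice (l i) with h | h
    · left
      intro x hx
      rw [hquad]
      exact hmain l (fun j => (abs_le.1 (hbd j)).1) h.symm x hx
    · right
      intro x hx
      rw [hquad, ← Finset.sum_neg_distrib]
      simp only [← neg_mul]
      exact hmain (fun j => -l j) (fun j => neg_le_neg (abs_le.1 (hbd j)).2) h.symm x hx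

/-! ### Scalar inequalities behind the constants -/

/-- After taking logarithms, `-log (1 - s) - s` must be bounded by a quadratic term. For `s ≥ 0` use
`x ≤ sinh x` at `x = -log (1 - s)`; for `s ≤ 0` use `log (1 + u) ≥ 2u / (u + 2)` at `u = -s`. -/
theorem inv_one_sub_mul_exp_neg_le {s : ℝ} (hs : |s| < 1) :
    (1 - s)⁻¹ * Real.exp (-s) ≤ Real.exp (s ^ 2 / 2 / (1 - |s|)) := by
  have hs1 : 0 < 1 - s := by linarith [le_abs_self s]
  rw [← Real.exp_log (inv_pos.2 hs1), ← Real.exp_add, Real.exp_le_exp, Real.log_inv]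
  have hpos : 0 < 1 - |s| := by linarith
  rcases le_total 0 s with h | h
  · rw [abs_of_nonneg h]
    have h1 : -Real.log (1 - s) ≤ ((1 - s)⁻¹ - (1 - s)) / 2 := by
      have hl : 0 ≤ -Real.log (1 - s) := by
        have := Real.log_nonpos hs1.le (by linarith)
        linarith
      have := Real.self_le_sinh_iff.2 hl
      rwa [Real.sinh_eq, neg_neg, Real.exp_neg, Real.exp_log hs1] at this
    have h2 : ((1 - s)⁻¹ - (1 - s)) / 2 + -s = s ^ 2 / 2 / (1 - s) := by
      field_simp
      ring
    linarith
  · rw [abs_of_nonpos h] at hpos ⊢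
    have h1 := Real.le_log_one_add_of_nonneg (x := -s) (by linarith)
    rw [← sub_eq_add_neg] at h1
    have h2 : s ^ 2 / 2 ≤ s ^ 2 / 2 / (1 - -s) :=
      le_div_self (by positivity) hpos (by linarith)
    have h3 : -(2 * -s / (-s + 2)) + -s ≤ s ^ 2 / 2 := by
      have h4 : 0 < -s + 2 := by linarith
      have h5 : -(2 * -s / (-s + 2)) + -s = s ^ 2 / (-s + 2) := by
        field_simp
        ring
      rw [h5]
      exact div_le_div_of_nonneg_left (by positivity) (by norm_num) (by linarith)
    linarith

/-- This fixes the tilt `l = σ² θ`, with `s` standing for `S / σ`. On the left are the exponential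
moment, the target `p / 2` and the cost `p log 5` of the cone; on the right is the gain at level
`3τ/5`, rescaled. -/
theorem exists_tilt {p n : ℕ} (hp : 0 < p) {s : ℝ} (hs : 0 ≤ s) :
    ∃ l : ℝ, 0 < l ∧ l < 1 ∧ (n * (l ^ 2 / 2) + l ^ 2 * s ^ 2) / (1 - l) + p / 2 + p * Real.log 5 ≤
      l * (3 / 5 * (6 * s * √(p : ℝ) + 8 * max (√((p : ℝ) * n)) (p : ℝ))) := by
  have hp' : (0 : ℝ) < p := by exact_mod_cast hp
  have hw2 : (p : ℝ) = √(p : ℝ) ^ 2 := (Real.sq_sqrt hp'.le).symm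
  have hN2 : (n : ℝ) = √(n : ℝ) ^ 2 := (Real.sq_sqrt (Nat.cast_nonneg n)).symm
  have hw0 : 0 < √(p : ℝ) := Real.sqrt_pos.2 hp'
  have hN0 : 0 ≤ √(n : ℝ) := Real.sqrt_nonneg _
  have hmax : max (√((p : ℝ) * n)) (p : ℝ) = √(p : ℝ) * max (√(n : ℝ)) (√(p : ℝ)) := by
    rw [mul_max_of_nonneg _ _ hw0.le, Real.sqrt_mul hp'.le, Real.mul_self_sqrt hp'.le]
  rw [hmax]
  have hlog : Real.log 5 ≤ 1.637 := by
    have h1 : Real.log 5 = 2 * Real.log 2 + Real.log (5 / 4) := by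
      rw [Real.log_div (by norm_num) (by norm_num), show (4 : ℝ) = 2 ^ 2 by norm_num, Real.log_pow]
      push_cast
      ring
    have h2 := Real.log_two_lt_d9
    have h3 := Real.log_le_sub_one_of_pos (show (0 : ℝ) < 5 / 4 by norm_num)
    linarith
  set w := √(p : ℝ)
  set N := √(n : ℝ)
  set m := max N w
  have hNm : N ≤ m := le_max_left _ _
  have hwm : w ≤ m := le_max_right _ _
  have hm0 : 0 < m := hw0.trans_le hwm
  set D := 2 * m + s with hD
  have hD0 : 0 < D := by positivity
  have hms : 0 < m + s := by positivity
  -- Since `w ≤ m`, the choice `D = 2 m + s` keeps `l ≤ 1/2` and makes `1 - l ≥ (m + s) / D`.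
  refine ⟨w / D, by positivity, (div_lt_one hD0).2 (by linarith), ?_⟩
  have h1l : (m + s) / D ≤ 1 - w / D := by
    rw [div_le_iff₀ hD0, sub_mul, div_mul_cancel₀ _ hD0.ne']
    linarith
  have hquot : (n * ((w / D) ^ 2 / 2) + (w / D) ^ 2 * s ^ 2) / (1 - w / D) ≤
      w ^ 2 * (m ^ 2 / 2 + s ^ 2) / (D * (m + s)) := by
    calc (n * ((w / D) ^ 2 / 2) + (w / D) ^ 2 * s ^ 2) / (1 - w / D)
        ≤ (m ^ 2 * ((w / D) ^ 2 / 2) + (w / D) ^ 2 * s ^ 2) / ((m + s) / D) := by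
          rw [hN2]
          gcongr
      _ = _ := by field_simp
  -- `2.137 = 1/2 + 1.637`. What remains is a quadratic form in `m` and `s` with nonnegative
  -- coefficients; that of `m²` is only `4.8 - 0.5 - 4.274 = 0.026`.
  have hmain : w ^ 2 * (m ^ 2 / 2 + s ^ 2) / (D * (m + s)) + 2.137 * w ^ 2 ≤
      w / D * (3 / 5 * (6 * s * w + 8 * (w * m))) := by
    rw [← sub_nonneg]
    have : w / D * (3 / 5 * (6 * s * w + 8 * (w * m))) -
        (w ^ 2 * (m ^ 2 / 2 + s ^ 2) / (D * (m + s)) + 2.137 * w ^ 2) =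
        w ^ 2 / (D * (m + s)) * (3 / 5 * (6 * s + 8 * m) * (m + s) - (m ^ 2 / 2 + s ^ 2) -
          2.137 * (D * (m + s))) := by
      field_simp
      ring
    rw [this]
    refine mul_nonneg (by positivity) ?_
    rw [hD]
    nlinarith [mul_nonneg hm0.le hs, sq_nonneg m, sq_nonneg s]
  rw [hw2]
  have := mul_le_mul_of_nonneg_left hlog (sq_nonneg w)
  linarith

/-! ### Tail bound for the perturbed Gram matrix -/

/-- The quadratic form of `(M + Z) (M + Z)ᴴ - M Mᴴ - n v I`. -/
noncomputable def gramDiff {p n : ℕ} (M : Matrix (Fin p) (Fin n) ℂ) (v : ℝ)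
    (Z : Fin p × Fin n → ℂ) (x : Fin p → ℂ) : ℝ :=
  ∑ j, (‖(star x ᵥ* M) j + (star x ᵥ* Matrix.of (Function.curry Z)) j‖ ^ 2 -
    ‖(star x ᵥ* M) j‖ ^ 2) - n * v * ∑ i, ‖x i‖ ^ 2

theorem measurable_gramDiff {p n : ℕ} (M : Matrix (Fin p) (Fin n) ℂ) (v : ℝ) :
    Measurable fun q : (Fin p × Fin n → ℂ) × (Fin p → ℂ) => gramDiff M v q.1 q.2 := by
  unfold gramDiff Matrix.vecMul dotProduct
  simp only [Pi.star_apply, Matrix.of_apply, Function.curry_apply]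
  fun_prop

theorem gramDiff_zero {p n : ℕ} (M : Matrix (Fin p) (Fin n) ℂ) (v : ℝ)
    (Z : Fin p × Fin n → ℂ) : gramDiff M v Z 0 = 0 := by
  simp [gramDiff]

theorem gramDiff_smul {p n : ℕ} (M : Matrix (Fin p) (Fin n) ℂ) (v : ℝ)
    (Z : Fin p × Fin n → ℂ) (c : ℝ) (x : Fin p → ℂ) :
    gramDiff M v Z ((c : ℂ) • x) = c ^ 2 * gramDiff M v Z x := by
  simp only [gramDiff, star_smul, Matrix.smul_vecMul, Pi.smul_apply, ← smul_add, norm_smul,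
    norm_star, Complex.norm_real, mul_pow, Real.norm_eq_abs, sq_abs, ← mul_sub, ← Finset.mul_sum]
  ring

/-- For a unit vector `x` the row `xᴴ Z` is white noise in `ℂⁿ`, so the integral factors over the
columns. The centring `-n v` gives each factor an `exp (-v θ)`, which cancels the first-order term.
The bound depends only on `|θ|`, so it serves both signs. -/
theorem lintegral_exp_gramDiff_le {p n : ℕ} (M : Matrix (Fin p) (Fin n) ℂ) {v : ℝ≥0} (hv : v ≠ 0)
    {θ : ℝ} (hθ : |v * θ| < 1) {S : ℝ} {x : Fin p → ℂ} (hx : ∑ i, ‖x i‖ ^ 2 = 1)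
    (hS : ∑ j, ‖(star x ᵥ* M) j‖ ^ 2 ≤ S ^ 2) :
    ∫⁻ Z, ENNReal.ofReal (Real.exp (θ * gramDiff M v Z x))
      ∂(Measure.pi fun _ : Fin p × Fin n => complexGaussian v) ≤
      ENNReal.ofReal (Real.exp ((n * ((v * θ) ^ 2 / 2) + v * θ ^ 2 * S ^ 2) / (1 - |v * θ|))) := by
  set μ := star x ᵥ* M
  -- `A` is `Z ↦ xᴴ Z` acting on all entries of `Z`; its rows are orthonormal because `x` is a unit
  -- vector.
  set A : Matrix (Fin n) (Fin p × Fin n) ℂ :=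
    Matrix.of fun j ij => if ij.2 = j then star (x ij.1) else 0 with hAdef
  have hAZ : ∀ Z : Fin p × Fin n → ℂ, star x ᵥ* Matrix.of (Function.curry Z) = A *ᵥ Z := by
    intro Z
    ext j
    simp [A, Matrix.vecMul, Matrix.mulVec, dotProduct, Fintype.sum_prod_type]
  have hA : A * Aᴴ = 1 := by
    ext j k
    rw [Matrix.mul_apply, Matrix.one_apply, Fintype.sum_prod_type]
    simp only [hAdef, Matrix.conjTranspose_apply, Matrix.of_apply]
    split_ifs with h
    · subst h
      have : ∀ i, ∑ l, (if l = j then star (x i) else 0) * star (if l = j then star (x i) else 0) =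
          ((‖x i‖ ^ 2 : ℝ) : ℂ) := by
        intro i
        rw [Finset.sum_eq_single j (fun l _ hl => by simp [hl]) (by simp)]
        simp [Complex.conj_mul']
      simp only [this, ← Complex.ofReal_sum, hx, Complex.ofReal_one]
    · refine Finset.sum_eq_zero fun i _ => Finset.sum_eq_zero fun l _ => ?_
      by_cases hl : l = j
      · subst hl; simp [h]
      · simp [hl]
  have hs1 : 0 < 1 - |v * θ| := by linarith
  have hs2 : 1 - |v * θ| ≤ 1 - v * θ := by linarith [le_abs_self (v * θ)]
  set f : Fin n → ℂ → ℝ≥0∞ := fun j z =>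
    ENNReal.ofReal (Real.exp (θ * (‖μ j + z‖ ^ 2 - ‖μ j‖ ^ 2))) *
      ENNReal.ofReal (Real.exp (-(v * θ))) with hf
  have hfm : ∀ j, Measurable (f j) := fun j => by fun_prop
  have hmeas : Measurable fun Z : Fin p × Fin n → ℂ => A *ᵥ Z := by
    unfold Matrix.mulVec dotProduct
    fun_prop
  have hprod : ∀ Z, ENNReal.ofReal (Real.exp (θ * gramDiff M v Z x)) = ∏ j, f j ((A *ᵥ Z) j) := by
    intro Z
    simp only [hf]
    simp only [← ENNReal.ofReal_mul (Real.exp_pos _).le, ← Real.exp_add]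
    rw [← ENNReal.ofReal_prod_of_nonneg fun _ _ => (Real.exp_pos _).le, ← Real.exp_sum]
    congr 2
    rw [gramDiff, hx, hAZ, Finset.sum_add_distrib, ← Finset.mul_sum]
    simp
    ring
  simp_rw [hprod]
  rw [← lintegral_map (f := fun y : Fin n → ℂ => ∏ j, f j (y j)) (by fun_prop) hmeas,
    map_mulVec_pi_complexGaussian v A hA, lintegral_pi_prod_eq_prod _ hfm]
  calc ∏ j, ∫⁻ z, f j z ∂complexGaussian v
      ≤ ∏ j, ENNReal.ofReal (Real.exp (((v * θ) ^ 2 / 2 + v * θ ^ 2 * ‖μ j‖ ^ 2) /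
          (1 - |v * θ|))) := by
        refine Finset.prod_le_prod' fun j _ => ?_
        rw [hf, lintegral_mul_const _ (by fun_prop),
          lintegral_exp_normSq_complexGaussian hv (lt_of_abs_lt hθ),
          ← ENNReal.ofReal_mul (by
            have : 0 < 1 - v * θ := by linarith
            positivity)]
        refine ENNReal.ofReal_le_ofReal ?_
        rw [mul_right_comm, add_div, Real.exp_add]
        have h1 := inv_one_sub_mul_exp_neg_le hθ
        have h2 : v * θ ^ 2 * ‖μ j‖ ^ 2 / (1 - v * θ) ≤ v * θ ^ 2 * ‖μ j‖ ^ 2 / (1 - |v * θ|) :=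
          div_le_div_of_nonneg_left (by positivity) hs1 hs2
        exact mul_le_mul h1 (Real.exp_le_exp.2 h2) (Real.exp_pos _).le (Real.exp_pos _).le
    _ = ENNReal.ofReal (Real.exp ((n * ((v * θ) ^ 2 / 2) + v * θ ^ 2 * ∑ j, ‖μ j‖ ^ 2) /
          (1 - |v * θ|))) := by
        rw [← ENNReal.ofReal_prod_of_nonneg fun _ _ => (Real.exp_pos _).le, ← Real.exp_sum,
          ← Finset.sum_div, Finset.sum_add_distrib, ← Finset.mul_sum]
        simp
    _ ≤ _ := by
        refine ENNReal.ofReal_le_ofReal (Real.exp_le_exp.2 ?_)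
        gcongr

/-- A large quadratic form on a cone around some unit vector is unlikely. -/
theorem measure_exists_cone_le {p n : ℕ} (hp : 0 < p) (M : Matrix (Fin p) (Fin n) ℂ)
    {σ : ℝ≥0} (hσ : σ ≠ 0) {S : ℝ} (hS0 : 0 ≤ S)
    (hS : ∀ x : Fin p → ℂ, ∑ j, ‖(star x ᵥ* M) j‖ ^ 2 ≤ S ^ 2 * ∑ i, ‖x i‖ ^ 2) {τ : ℝ}
    (hτ : τ = 6 * σ * S * √(p : ℝ) + 8 * σ ^ 2 * max (√((p : ℝ) * n)) (p : ℝ)) :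
    (Measure.pi fun _ : Fin p × Fin n => complexGaussian (σ ^ 2))
      {Z | ∃ e : EuclideanSpace ℂ (Fin p), ‖e‖ = 1 ∧
        ((∀ x : Fin p → ℂ, (1 - 1 / 5) * ‖WithLp.toLp 2 x‖ ^ 2 ≤ ‖⟪e, WithLp.toLp 2 x⟫_ℂ‖ ^ 2 →
            3 / 5 * τ * ‖WithLp.toLp 2 x‖ ^ 2 ≤ gramDiff M (σ ^ 2) Z x) ∨
          ∀ x : Fin p → ℂ, (1 - 1 / 5) * ‖WithLp.toLp 2 x‖ ^ 2 ≤ ‖⟪e, WithLp.toLp 2 x⟫_ℂ‖ ^ 2 →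
            3 / 5 * τ * ‖WithLp.toLp 2 x‖ ^ 2 ≤ -gramDiff M (σ ^ 2) Z x)} ≤
      ENNReal.ofReal (3 * Real.exp (-(p : ℝ) / 2)) := by
  have hσ0 : 0 < (σ : ℝ) := by positivity
  obtain ⟨l, hl0, hl1, hl⟩ := exists_tilt (n := n) hp (div_nonneg hS0 hσ0.le : 0 ≤ S / σ)
  set θ := l / σ ^ 2 with hθ
  have hvθ : ((σ ^ 2 : ℝ≥0) : ℝ) * θ = l := by
    rw [hθ]; push_cast; field_simp
  set K := (n * (l ^ 2 / 2) + l ^ 2 * (S / σ) ^ 2) / (1 - l) with hK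
  have hK0 : 0 ≤ K := div_nonneg (by positivity) (by linarith)
  -- Normalising the Gaussian vector `x` makes it a random direction; at `x = 0` the convention `0⁻¹
  -- = 0` is harmless.
  set N : (Fin p → ℂ) → ℝ := fun x => (√(∑ i, ‖x i‖ ^ 2))⁻¹ with hN
  have hNm : Measurable N := by fun_prop
  have hnorm : ∀ x : Fin p → ℂ, ‖WithLp.toLp 2 x‖ ^ 2 = ∑ i, ‖x i‖ ^ 2 := fun x =>
    EuclideanSpace.norm_sq_eq _
  set P := Measure.pi fun _ : Fin p × Fin n => complexGaussian (σ ^ 2)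
  set Q := Measure.pi fun _ : Fin p => complexGaussian 1
  set F : ℝ → (Fin p × Fin n → ℂ) → (Fin p → ℂ) → ℝ≥0∞ := fun ε Z x =>
    ENNReal.ofReal (Real.exp (ε * θ * gramDiff M (σ ^ 2) Z ((N x : ℂ) • x))) with hF
  have hFm : ∀ ε, Measurable fun q : (Fin p × Fin n → ℂ) × (Fin p → ℂ) => F ε q.1 q.2 := by
    intro ε
    have h1 : Measurable fun q : (Fin p × Fin n → ℂ) × (Fin p → ℂ) =>
        (q.1, (N q.2 : ℂ) • q.2) := by fun_prop
    have h2 := (measurable_gramDiff M (σ ^ 2)).comp h1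
    exact ((h2.const_mul (ε * θ)).exp).ennreal_ofReal
  have hbound : ∀ ε : ℝ, |ε| = 1 → ∀ x, ∫⁻ Z, F ε Z x ∂P ≤ ENNReal.ofReal (Real.exp K) := by
    intro ε hε x
    by_cases hx : x = 0
    · subst hx
      simp only [hF, smul_zero, gramDiff_zero, mul_zero, Real.exp_zero, lintegral_const,
        measure_univ, mul_one]
      exact ENNReal.ofReal_le_ofReal (Real.one_le_exp hK0)
    · have hpos : 0 < ∑ i, ‖x i‖ ^ 2 := by
        rw [← hnorm]
        have : WithLp.toLp 2 x ≠ 0 := by simpa using hx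
        positivity
      have hx1 : ∑ i, ‖((N x : ℂ) • x) i‖ ^ 2 = 1 := by
        simp only [Pi.smul_apply, norm_smul, Complex.norm_real, mul_pow, Real.norm_eq_abs, sq_abs,
          ← Finset.mul_sum, hN, inv_pow, Real.sq_sqrt hpos.le]
        exact inv_mul_cancel₀ hpos.ne'
      have hvε : ((σ ^ 2 : ℝ≥0) : ℝ) * (ε * θ) = ε * l := by rw [mul_left_comm, hvθ]
      have habs : |((σ ^ 2 : ℝ≥0) : ℝ) * (ε * θ)| = l := by
        rw [hvε, abs_mul, hε, one_mul, abs_of_pos hl0]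
      have h := lintegral_exp_gramDiff_le M (v := σ ^ 2) (by positivity) (θ := ε * θ)
        (by rw [habs]; exact hl1) (S := S) hx1 ((hS _).trans_eq (by rw [hx1, mul_one]))
      refine h.trans_eq ?_
      have hε2 : ε ^ 2 = 1 := by rw [← sq_abs, hε, one_pow]
      have h1 : ((σ ^ 2 : ℝ≥0) : ℝ) * (ε * θ) ^ 2 * S ^ 2 = l ^ 2 * (S / σ) ^ 2 := by
        rw [mul_pow, hε2, hθ]
        push_cast
        field_simp
      have h2 : (((σ ^ 2 : ℝ≥0) : ℝ) * (ε * θ)) ^ 2 = l ^ 2 := by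
        rw [hvε, mul_pow, hε2, one_mul]
      rw [habs, h1, h2]
  set c := ENNReal.ofReal (Real.exp (θ * (3 / 5 * τ)))
  have hlower : ∀ ε : ℝ, ∀ Z, (∃ e : EuclideanSpace ℂ (Fin p), ‖e‖ = 1 ∧
      ∀ x : Fin p → ℂ, (1 - 1 / 5) * ‖WithLp.toLp 2 x‖ ^ 2 ≤ ‖⟪e, WithLp.toLp 2 x⟫_ℂ‖ ^ 2 →
        3 / 5 * τ * ‖WithLp.toLp 2 x‖ ^ 2 ≤ ε * gramDiff M (σ ^ 2) Z x) →
      c * ENNReal.ofReal ((1 / 5) ^ p) ≤ ∫⁻ x, F ε Z x ∂Q := by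
    rintro ε Z ⟨e, he, hcone⟩
    have hmeasF : Measurable (F ε Z) := (hFm ε).of_uncurry_left
    refine le_trans ?_ (mul_meas_ge_le_lintegral hmeasF c)
    refine mul_le_mul_right ((le_pi_complexGaussian_cone hp (by norm_num) (by norm_num) he).trans
      (measure_mono ?_)) c
    rintro x ⟨hx0, hx⟩
    have hpos : 0 < ‖WithLp.toLp 2 x‖ ^ 2 := by
      have : WithLp.toLp 2 x ≠ 0 := by simpa using hx0
      positivity
    refine ENNReal.ofReal_le_ofReal (Real.exp_le_exp.2 ?_)
    have hNx : N x ^ 2 = (‖WithLp.toLp 2 x‖ ^ 2)⁻¹ := by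
      simp only [hN, inv_pow, hnorm]
      rw [Real.sq_sqrt (by positivity)]
    rw [gramDiff_smul, hNx, mul_comm ε θ, mul_assoc]
    refine mul_le_mul_of_nonneg_left ?_ (by positivity)
    rw [mul_left_comm, ← div_eq_inv_mul, le_div_iff₀ hpos]
    exact hcone x hx
  -- Adding the averages for both signs treats large positive and large negative forms at once, at
  -- the price of a factor 2. The event, an existential over `e`, need not be measurable: it lies in
  -- the measurable set `{c0 ≤ G}`.
  set G : (Fin p × Fin n → ℂ) → ℝ≥0∞ := fun Z => ∫⁻ x, F 1 Z x ∂Q + ∫⁻ x, F (-1) Z x ∂Q with hG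
  have hGm : Measurable G := (hFm 1).lintegral_prod_right'.add (hFm (-1)).lintegral_prod_right'
  have hGint : ∫⁻ Z, G Z ∂P ≤ 2 * ENNReal.ofReal (Real.exp K) := by
    rw [hG, lintegral_add_left (hFm 1).lintegral_prod_right', two_mul]
    have : ∀ ε : ℝ, |ε| = 1 → ∫⁻ Z, ∫⁻ x, F ε Z x ∂Q ∂P ≤ ENNReal.ofReal (Real.exp K) := by
      intro ε hε
      rw [lintegral_lintegral_swap (hFm ε).aemeasurable]
      refine (lintegral_mono (hbound ε hε)).trans_eq ?_
      rw [lintegral_const, measure_univ, mul_one]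
    exact add_le_add (this 1 (by simp)) (this (-1) (by simp))
  set c0 := c * ENNReal.ofReal ((1 / 5) ^ p) with hc0
  have hmarkov := (mul_meas_ge_le_lintegral hGm c0).trans hGint
  refine (measure_mono (t := {Z | c0 ≤ G Z}) ?_).trans ?_
  · rintro Z ⟨e, he, h | h⟩
    · exact (hlower 1 Z ⟨e, he, by simpa only [one_mul] using h⟩).trans le_self_add
    · exact (hlower (-1) Z ⟨e, he, by simpa only [neg_one_mul] using h⟩).trans le_add_self
  have hc0' : c0 = ENNReal.ofReal (Real.exp (θ * (3 / 5 * τ)) * (1 / 5) ^ p) := by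
    rw [hc0, ENNReal.ofReal_mul (Real.exp_pos _).le]
  have hcpos : 0 < Real.exp (θ * (3 / 5 * τ)) * (1 / 5 : ℝ) ^ p := by positivity
  have hc0ne : c0 ≠ 0 := by rw [hc0']; exact (ENNReal.ofReal_pos.2 hcpos).ne'
  have hc0top : c0 ≠ ⊤ := by rw [hc0']; exact ENNReal.ofReal_ne_top
  rw [← ENNReal.mul_le_mul_iff_right hc0ne hc0top]
  refine hmarkov.trans ?_
  rw [hc0', ← ENNReal.ofReal_mul hcpos.le, show (2 : ℝ≥0∞) = ENNReal.ofReal 2 by simp,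
    ← ENNReal.ofReal_mul zero_le_two]
  refine ENNReal.ofReal_le_ofReal ?_
  have hpow : (1 / 5 : ℝ) ^ p = Real.exp (-(p * Real.log 5)) := by
    rw [Real.exp_neg, ← Real.log_pow, Real.exp_log (by positivity), one_div, inv_pow]
  have hθτ : θ * (3 / 5 * τ) =
      l * (3 / 5 * (6 * (S / σ) * √(p : ℝ) + 8 * max (√((p : ℝ) * n)) (p : ℝ))) := by
    rw [hθ, hτ]
    field_simp
  rw [hpow, hθτ, mul_left_comm, ← Real.exp_add, ← Real.exp_add]
  -- The argument gives the factor 2, which is relaxed to 3.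
  refine mul_le_mul (by norm_num) (Real.exp_le_exp.2 ?_) (Real.exp_pos _).le (by norm_num)
  linarith

/-! ### The Gram difference as a symmetric operator -/

theorem norm_toEuclideanLin_conjTranspose_apply {p n : ℕ} (N : Matrix (Fin p) (Fin n) ℂ)
    (x : Fin p → ℂ) (j : Fin n) :
    ‖Matrix.toEuclideanLin Nᴴ (WithLp.toLp 2 x) j‖ = ‖(star x ᵥ* N) j‖ := by
  have h : Nᴴ *ᵥ x = star (star x ᵥ* N) := by
    rw [Matrix.star_vecMul, star_star]
  rw [Matrix.toLpLin_toLp]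
  change ‖(Nᴴ *ᵥ x) j‖ = _
  rw [h, Pi.star_apply, norm_star]

/-- The operator `N Nᴴ - M Mᴴ - c I`. -/
noncomputable def gramDiffLin {p n : ℕ} (M N : Matrix (Fin p) (Fin n) ℂ) (c : ℝ) :
    EuclideanSpace ℂ (Fin p) →ₗ[ℂ] EuclideanSpace ℂ (Fin p) :=
  (Matrix.toEuclideanLin Nᴴ).adjoint ∘ₗ Matrix.toEuclideanLin Nᴴ -
    (Matrix.toEuclideanLin Mᴴ).adjoint ∘ₗ Matrix.toEuclideanLin Mᴴ - (c : ℂ) • LinearMap.id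

theorem inner_gramDiffLin {p n : ℕ} (M N : Matrix (Fin p) (Fin n) ℂ) (c : ℝ)
    (y x : EuclideanSpace ℂ (Fin p)) :
    ⟪y, gramDiffLin M N c x⟫_ℂ =
      ⟪Matrix.toEuclideanLin Nᴴ y, Matrix.toEuclideanLin Nᴴ x⟫_ℂ -
        ⟪Matrix.toEuclideanLin Mᴴ y, Matrix.toEuclideanLin Mᴴ x⟫_ℂ - c * ⟪y, x⟫_ℂ := by
  simp only [gramDiffLin, LinearMap.sub_apply, LinearMap.comp_apply, LinearMap.smul_apply,
    LinearMap.id_apply, inner_sub_right, inner_smul_right, LinearMap.adjoint_inner_right]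

theorem isSymmetric_gramDiffLin {p n : ℕ} (M N : Matrix (Fin p) (Fin n) ℂ) (c : ℝ) :
    (gramDiffLin M N c).IsSymmetric := by
  intro x y
  rw [← inner_conj_symm, inner_gramDiffLin, inner_gramDiffLin]
  simp only [map_sub, map_mul, inner_conj_symm, Complex.conj_ofReal]

theorem gramDiff_eq_re_inner {p n : ℕ} (M : Matrix (Fin p) (Fin n) ℂ) (v : ℝ)
    (Z : Fin p × Fin n → ℂ) (x : Fin p → ℂ) :
    gramDiff M v Z x = (⟪WithLp.toLp 2 x,
      gramDiffLin M (M + Matrix.of (Function.curry Z)) (n * v) (WithLp.toLp 2 x)⟫_ℂ).re := by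
  rw [inner_gramDiffLin]
  simp only [inner_self_eq_norm_sq_to_K, Complex.coe_algebraMap, ← Complex.ofReal_pow,
    ← Complex.ofReal_mul, ← Complex.ofReal_sub, Complex.ofReal_re, EuclideanSpace.norm_sq_eq,
    norm_toEuclideanLin_conjTranspose_apply, Matrix.vecMul_add, Pi.add_apply, gramDiff,
    Finset.sum_sub_distrib]

theorem IsSVD.sum_norm_sq_vecMul_le {p n : ℕ} {M : Matrix (Fin p) (Fin n) ℂ}
    {s : Fin (min p n) → ℝ} {u : Matrix (Fin p) (Fin (min p n)) ℂ}
    {v : Matrix (Fin n) (Fin (min p n)) ℂ} (h : IsSVD M s u v) (h0 : 0 < min p n)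
    (x : Fin p → ℂ) :
    ∑ j, ‖(star x ᵥ* M) j‖ ^ 2 ≤ s ⟨0, h0⟩ ^ 2 * ∑ i, ‖x i‖ ^ 2 := by
  simp only [← norm_toEuclideanLin_conjTranspose_apply]
  rw [← EuclideanSpace.norm_sq_eq]
  have h1 := congrArg Complex.re (h.inner_conjTranspose (WithLp.toLp 2 x) (WithLp.toLp 2 x))
  rw [spectralForm_self_re] at h1
  rw [← inner_self_eq_norm_sq (𝕜 := ℂ), RCLike.re_to_complex, h1]
  calc ∑ j, s j ^ 2 * ‖⟪colVec u j, WithLp.toLp 2 x⟫_ℂ‖ ^ 2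
      ≤ ∑ j, s ⟨0, h0⟩ ^ 2 * ‖⟪colVec u j, WithLp.toLp 2 x⟫_ℂ‖ ^ 2 := by
        refine Finset.sum_le_sum fun j _ => ?_
        have := h.nonneg j
        have := h.antitone (Fin.le_def.2 (Nat.zero_le (j : ℕ)) : (⟨0, h0⟩ : Fin (min p n)) ≤ j)
        gcongr
    _ = s ⟨0, h0⟩ ^ 2 * ∑ j, ‖⟪colVec u j, WithLp.toLp 2 x⟫_ℂ‖ ^ 2 := by rw [Finset.mul_sum]
    _ ≤ s ⟨0, h0⟩ ^ 2 * ‖(WithLp.toLp 2 x : EuclideanSpace ℂ (Fin p))‖ ^ 2 :=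
        mul_le_mul_of_nonneg_left
          ((orthonormal_colVec h.left_orthonormal).sum_inner_products_le _) (sq_nonneg _)
    _ = _ := by rw [EuclideanSpace.norm_sq_eq]

theorem complexGaussian_zero : complexGaussian 0 = Measure.dirac 0 := by
  rw [complexGaussian, zero_div, gaussianReal_zero_var, Measure.dirac_prod_dirac,
    Measure.map_dirac' (by fun_prop)]
  rfl

/-- With high probability `(M + Z) (M + Z)ᴴ` is close to `M Mᴴ + n σ² I`. -/
theorem exists_measure_le_forall_notMem_norm_gramDiffLin_le {p n : ℕ} (hp : 0 < p)
    (M : Matrix (Fin p) (Fin n) ℂ) (σ : ℝ≥0) {S : ℝ} (hS0 : 0 ≤ S)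
    (hS : ∀ x : Fin p → ℂ, ∑ j, ‖(star x ᵥ* M) j‖ ^ 2 ≤ S ^ 2 * ∑ i, ‖x i‖ ^ 2) {τ : ℝ}
    (hτ : τ = 6 * σ * S * √(p : ℝ) + 8 * σ ^ 2 * max (√((p : ℝ) * n)) (p : ℝ)) :
    ∃ bad : Set (Fin p × Fin n → ℂ),
      (Measure.pi fun _ : Fin p × Fin n => complexGaussian (σ ^ 2)) bad ≤
        ENNReal.ofReal (3 * Real.exp (-(p : ℝ) / 2)) ∧
      ∀ Z ∉ bad, ∀ x,
        ‖gramDiffLin M (M + Matrix.of (Function.curry Z)) (n * σ ^ 2) x‖ ≤ τ * ‖x‖ := by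
  have hτ0 : 0 ≤ τ := by rw [hτ]; positivity
  -- The tilt `θ = l / σ²` needs `σ ≠ 0`; without noise `Z = 0` almost surely and the operator
  -- vanishes.
  by_cases hσ : σ = 0
  · subst hσ
    refine ⟨⋃ ij, {Z | Z ij ≠ 0}, ?_, ?_⟩
    · refine le_of_eq_of_le (measure_iUnion_null fun ij => ?_) zero_le
      have h := (measurePreserving_eval (fun _ : Fin p × Fin n => complexGaussian (0 ^ 2))
        ij).measure_preimage (measurableSet_singleton (0 : ℂ)).compl.nullMeasurableSet
      refine h.trans ?_
      rw [zero_pow two_ne_zero, complexGaussian_zero]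
      simp
    · intro Z hZ x
      have hZ0 : Z = 0 := by
        ext ij
        by_contra h
        exact hZ (Set.mem_iUnion.2 ⟨ij, h⟩)
      have hM : M + Matrix.of (Function.curry Z) = M := by
        ext i j
        simp [hZ0]
      have h0 : gramDiffLin M M (n * ((0 : ℝ≥0) : ℝ) ^ 2) = 0 := by
        simp [gramDiffLin]
      rw [hM, h0, LinearMap.zero_apply, norm_zero]
      positivity
  · refine ⟨_, measure_exists_cone_le hp M hσ hS0 hS hτ, ?_⟩
    intro Z hZ
    rcases (isSymmetric_gramDiffLin M (M + Matrix.of (Function.curry Z))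
      (n * σ ^ 2)).norm_le_or_exists_cone (η := 1 / 5) hτ0 (by norm_num) with h | ⟨e, he, h⟩
    · exact h
    · refine absurd ⟨e, he, h.imp (fun h x hx => ?_) fun h x hx => ?_⟩ hZ
      · rw [gramDiff_eq_re_inner]
        have := h _ hx
        norm_num at this ⊢
        exact this
      · rw [gramDiff_eq_re_inner]
        have := h _ hx
        norm_num at this ⊢
        exact this

/-! ### Transfer to the probability space and conclusion -/

theorem IsIIDComplexGaussian.map_eq_pi {Ω : Type*} [MeasurableSpace Ω] {μ : Measure Ω}
    [IsProbabilityMeasure μ] {p n : ℕ} {E : Ω → Matrix (Fin p) (Fin n) ℂ} {v : ℝ≥0}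
    (h : IsIIDComplexGaussian μ E v) :
    μ.map (fun ω (ij : Fin p × Fin n) => E ω ij.1 ij.2) =
      Measure.pi fun _ : Fin p × Fin n => complexGaussian v := by
  rw [(iIndepFun_iff_map_fun_eq_pi_map fun ij : Fin p × Fin n =>
    (h.hasLaw ij.1 ij.2).aemeasurable).1 h.indep]
  congr 1
  ext ij : 1
  exact (h.hasLaw ij.1 ij.2).map_eq

theorem perturbationBound_of_scaling {p n : ℕ} (hpn : p ≤ n) (σ a b c : ℝ) :
    perturbationBound p n σ (a * √(n : ℝ)) (b * √(n : ℝ)) (c * √(n : ℝ)) =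
      (12 * σ * a + 16 * σ ^ 2) / (b ^ 2 - c ^ 2) * √((p : ℝ) / n) := by
  rcases Nat.eq_zero_or_pos n with rfl | hn
  · obtain rfl : p = 0 := by omega
    simp [perturbationBound]
  have hn0 : (0 : ℝ) < n := by exact_mod_cast hn
  have hpn' : (p : ℝ) ≤ n := by exact_mod_cast hpn
  have hmax : max (√((p : ℝ) * n)) (p : ℝ) = √(p : ℝ) * √(n : ℝ) := by
    rw [← Real.sqrt_mul (Nat.cast_nonneg p)]
    refine max_eq_left (Real.le_sqrt_of_sq_le ?_)
    rw [sq]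
    exact mul_le_mul_of_nonneg_left hpn' (Nat.cast_nonneg p)
  have hs : 0 < √(n : ℝ) := Real.sqrt_pos.2 hn0
  rw [perturbationBound, hmax, Real.sqrt_div (Nat.cast_nonneg p), mul_pow, mul_pow, ← sub_mul,
    div_mul_div_comm]
  rw [show 12 * σ * (a * √(n : ℝ)) * √(p : ℝ) + 16 * σ ^ 2 * (√(p : ℝ) * √(n : ℝ)) =
    (12 * σ * a + 16 * σ ^ 2) * √(p : ℝ) * √(n : ℝ) by ring, sq (√(n : ℝ)), ← mul_assoc (b ^ 2 - c ^ 2),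
    mul_div_mul_right _ _ hs.ne']

theorem theorem5 {Ω : Type*} [MeasurableSpace Ω] (μ : Measure Ω) [IsProbabilityMeasure μ]
    {p n r : ℕ} (hr : 0 < r) (hrpn : r < min p n)
    (M : Matrix (Fin p) (Fin n) ℂ) (s : Fin (min p n) → ℝ)
    (u : Matrix (Fin p) (Fin (min p n)) ℂ) (v : Matrix (Fin n) (Fin (min p n)) ℂ)
    (hM : IsSVD M s u v)
    (hgap : s ⟨r, hrpn⟩ < s ⟨r - 1, (Nat.sub_le r 1).trans_lt hrpn⟩)
    (σ : ℝ≥0) (E : Ω → Matrix (Fin p) (Fin n) ℂ) (hE : IsIIDComplexGaussian μ E (σ ^ 2))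
    (B : ℝ)
    (hB : B = perturbationBound p n σ (s ⟨0, hr.trans hrpn⟩)
      (s ⟨r - 1, (Nat.sub_le r 1).trans_lt hrpn⟩) (s ⟨r, hrpn⟩)) :
    (B < 0.586 →
      ∃ A : Set Ω, MeasurableSet A ∧
        ENNReal.ofReal (1 - 3 * Real.exp (-(p : ℝ) / 2)) ≤ μ A ∧
        ∀ ω ∈ A, ∀ shat uhat vhat, IsSVD (M + E ω) shat uhat vhat →
          subspaceDist (firstCols hrpn.le uhat) (firstCols hrpn.le u) ≤ B) ∧
    (∀ a b c : ℝ, p ≤ n →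
      s ⟨0, hr.trans hrpn⟩ = a * √(n : ℝ) →
      s ⟨r - 1, (Nat.sub_le r 1).trans_lt hrpn⟩ = b * √(n : ℝ) →
      s ⟨r, hrpn⟩ = c * √(n : ℝ) →
      B = (12 * σ * a + 16 * σ ^ 2) / (b ^ 2 - c ^ 2) * √((p : ℝ) / n)) := by
  refine ⟨fun hB1 => ?_, fun a b c hpn h1 h2 h3 => ?_⟩
  · have hp : 0 < p := by omega
    have hs0 := hM.nonneg ⟨0, hr.trans hrpn⟩
    obtain ⟨bad, hbad, hgood⟩ := exists_measure_le_forall_notMem_norm_gramDiffLin_le hp M σ hs0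
      (hM.sum_norm_sq_vecMul_le (hr.trans hrpn)) rfl
    set τ := 6 * σ * s ⟨0, hr.trans hrpn⟩ * √(p : ℝ) +
      8 * σ ^ 2 * max (√((p : ℝ) * n)) (p : ℝ) with hτ
    have hτ0 : 0 ≤ τ := by positivity
    have hg : 0 < s ⟨r - 1, (Nat.sub_le r 1).trans_lt hrpn⟩ ^ 2 - s ⟨r, hrpn⟩ ^ 2 :=
      sub_pos.2 (pow_lt_pow_left₀ hgap (hM.nonneg _) two_ne_zero)
    have hBτ : B = 2 * τ / (s ⟨r - 1, (Nat.sub_le r 1).trans_lt hrpn⟩ ^ 2 - s ⟨r, hrpn⟩ ^ 2) := by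
      rw [hB, perturbationBound, hτ]
      congr 1
      ring
    have hmeas : AEMeasurable (fun ω (ij : Fin p × Fin n) => E ω ij.1 ij.2) μ :=
      aemeasurable_pi_lambda _ fun ij => (hE.hasLaw ij.1 ij.2).aemeasurable
    set badΩ : Set Ω := (fun ω (ij : Fin p × Fin n) => E ω ij.1 ij.2) ⁻¹' bad
    have hbadΩ : μ badΩ ≤ ENNReal.ofReal (3 * Real.exp (-(p : ℝ) / 2)) := by
      rw [← hE.map_eq_pi] at hbad
      refine le_trans ?_ hbad
      -- `bad` is not known to be measurable, so its measurable hull is pulled back instead.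
      rw [← measure_toMeasurable bad,
        Measure.map_apply_of_aemeasurable hmeas (measurableSet_toMeasurable _ _)]
      exact measure_mono (Set.preimage_mono (subset_toMeasurable _ _))
    refine ⟨(toMeasurable μ badΩ)ᶜ, (measurableSet_toMeasurable _ _).compl, ?_, ?_⟩
    · rw [prob_compl_eq_one_sub (measurableSet_toMeasurable _ _), measure_toMeasurable,
        ENNReal.ofReal_sub _ (by positivity), ENNReal.ofReal_one]
      exact tsub_le_tsub_left hbadΩ 1
    · intro ω hω shat uhat vhat hsvd
      have hω' : (fun ij : Fin p × Fin n => E ω ij.1 ij.2) ∉ bad := fun h =>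
        hω (subset_toMeasurable μ badΩ h)
      -- The event depends on `E` alone, so the bound holds for every singular value decomposition
      -- of `M + E ω` simultaneously.
      refine subspaceDist_le hrpn hM hsvd hgap (c := n * σ ^ 2) (τ := τ) ?_ ?_ ?_ ?_
      · intro y x
        rw [← inner_gramDiffLin]
        have h := hgood _ hω' x
        calc ‖⟪y, gramDiffLin M (M + E ω) (n * σ ^ 2) x⟫_ℂ‖
            ≤ ‖y‖ * ‖gramDiffLin M (M + E ω) (n * σ ^ 2) x‖ := norm_inner_le_norm _ _
          _ ≤ ‖y‖ * (τ * ‖x‖) := mul_le_mul_of_nonneg_left h (norm_nonneg y)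
          _ = τ * ‖y‖ * ‖x‖ := by ring
      · rw [hBτ]
        positivity
      · norm_num at hB1
        linarith
      · rw [hBτ, div_mul_cancel₀ _ hg.ne']
  · rw [hB, h1, h2, h3]
    exact perturbationBound_of_scaling hpn σ a b c
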